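/- There is a function $c:(0,\infty)\to(0,\infty)$ and, for every integer $n\ge 2$, a constant $C>0$ depending only on $n$, such that the following holds. Let $f_\infty\ge 0$ and $K\ge 0$ be functions on $[0,\infty)$ such that $x\mapsto f_\infty(|x|)$ is a probability density on $\mathbb R^n$, and such that the function $x\mapsto K(|x|)f_\infty(|x|)$ is differentiable on $\mathbb R^n$ with $$\nabla\big[K(|x|)f_\infty(|x|)\big]+x\,f_\infty(|x|)=0\qquad (x\in\mathbb R^n).$$ Let $R>0$ be such that $(n-1)\,K(r)/r^2\le \tfrac12$ for all $r\ge R$. Let $w\ge0$ be a Borel function on $(0,\infty)$ such that the probability density $f(\rho)=\sigma_n\rho^{n-1}f_\infty(\rho)$ on $(0,\infty)$, where $\sigma_n=2\pi^{n/2}/\Gamma(n/2)$, satisfies the one-dimensional Poincaré inequality with weight $w$: for every bounded smooth function $\psi$ on $(0,\infty)$, $$\int_0^\infty\Big(\psi(\rho)-\int_0^\infty\psi(y)f(y)\,dy\Big)^2f(\rho)\,d\rho\le\int_0^\infty w(\rho)\,\psi'(\rho)^2f(\rho)\,d\rho .$$ Then for every smooth $\varphi:\mathbb R^n\to\mathbb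 R$ for which $|\varphi|+|\nabla\varphi|$ is bounded, $$\int_{\mathbb R^n}\varphi^2(x)f_\infty(|x|)\,dx-\Big(\int_{\mathbb R^n}\varphi(x)f_\infty(|x|)\,dx\Big)^2\le C\Big(\int_{\mathbb R^n}W(|x|)\,|\nabla\varphi(x)|^2f_\infty(|x|)\,dx+c(R)\int_{|x|=R}|\nabla\varphi(x)|^2f_\infty(|x|)\,d\sigma(x)\Big),$$ where $\sigma$ is the surface measure of the sphere $\{|x|=R\}$ and $$W(r)=\max\big(w(r),r^2\big)\ \text{ if } r\le R,\qquad W(r)=K(r)\ \text{ if } r>R .$$ The right-hand sides of both inequalities take values in $[0,\infty]$; an inequality whose right-hand side is $+\infty$ holds trivially. All functions are real-valued, and "smooth" means $C^\infty$. -/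

import Mathlib

open MeasureTheory Set
open scoped ContDiff Gradient

noncomputable section

/-- `σ_n = 2 π^{n/2} / Γ(n/2)`, the surface area of the unit sphere of `ℝⁿ`. -/
def sphereArea (n : ℕ) : ℝ :=
  2 * Real.pi ^ ((n : ℝ) / 2) / Real.Gamma ((n : ℝ) / 2)

/-- The `(n-1)`-dimensional surface measure of the sphere `{|x| = R}` of `ℝⁿ`, as a measure on
`ℝⁿ`: the image under `y ↦ R y` of the surface measure of the unit sphere, times `R ^ (n-1)`. -/
def surfaceMeasure (n : ℕ) (R : ℝ) : Measure (EuclideanSpace ℝ (Fin n)) :=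
  ENNReal.ofReal (R ^ (n - 1)) •
    Measure.map
      (fun y : Metric.sphere (0 : EuclideanSpace ℝ (Fin n)) 1 =>
        R • (y : EuclideanSpace ℝ (Fin n)))
      (volume : Measure (EuclideanSpace ℝ (Fin n))).toSphere

/-- The radial profile `f` gives a probability density `x ↦ f |x|` on `ℝⁿ`. -/
structure IsRadialProbDensity (n : ℕ) (f : ℝ → ℝ) : Prop where
  measurable : Measurable f
  nonneg : ∀ r, 0 ≤ r → 0 ≤ f r
  lintegral_eq_one : ∫⁻ x : EuclideanSpace ℝ (Fin n), ENNReal.ofReal (f ‖x‖) = 1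

/-- The stationary equation `∇ [K(|x|) f(|x|)] + x f(|x|) = 0` on `ℝⁿ`, in the classical sense. -/
def IsRadialSteadyState (n : ℕ) (K f : ℝ → ℝ) : Prop :=
  ∀ x : EuclideanSpace ℝ (Fin n),
    HasGradientAt (fun y : EuclideanSpace ℝ (Fin n) => K ‖y‖ * f ‖y‖) (-(f ‖x‖ • x)) x

/-- The one-dimensional weighted Poincaré inequality on the open set `I`, for the probability
density `g` and the weight `w`: `Var[ψ(X)] ≤ E[w(X) ψ'(X)²]` for all bounded smooth `ψ` on `I`.
The right-hand side is a Lebesgue integral in `[0, ∞]`, so the inequality says something only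
when that integral is finite. -/
def WeightedPoincareOn (I : Set ℝ) (g w : ℝ → ℝ) : Prop :=
  ∀ ψ : ℝ → ℝ, ContDiffOn ℝ ∞ ψ I → (∃ M : ℝ, ∀ ρ ∈ I, |ψ ρ| ≤ M) →
    ENNReal.ofReal (∫ ρ in I, (ψ ρ - ∫ y in I, ψ y * g y) ^ 2 * g ρ) ≤
      ∫⁻ ρ in I, ENNReal.ofReal (w ρ * deriv ψ ρ ^ 2 * g ρ)

/-- `W(r) = max (w(r), r²)` for `r ≤ R` and `W(r) = K(r)` for `r > R`. -/
def hybridWeight (w K : ℝ → ℝ) (R r : ℝ) : ℝ :=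
  if r ≤ R then max (w r) (r ^ 2) else K r

end

/-!
The proof works in polar coordinates. Write `X = ρ θ` for a point with density `f |x|`: the
direction `θ` is uniform on the unit sphere and independent of the radius `ρ`, whose law
`radialLaw` has density `σ_n r ^ (n - 1) f r`. Let `Y = s η` be an independent copy of `X`. The
variance is at most the mean of `(φ X - φ Y) ^ 2`, and one passes from `X` to `Y` through the points
`min ρ R θ`, `min s R θ`, `min s R η`, in which the radii are stopped at `R`
(`lintegral_sq_sub_le_stopped`). Each of the four steps has its own inequality.

* From `ρ θ` to `min ρ R θ` (and from `s η` to `min s R η`). The stationary equation says that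
  `f` is `-1 / r` times the derivative of `K f`, so that integrating by parts against
  `g ^ 2 r ^ (n - 2)` gives a Hardy inequality on `(R, ∞)` with weight `K`; the hypothesis on
  `K / r ^ 2` absorbs the term in which the power is differentiated (`lintegral_Ioi_sq_le`).
* From `min ρ R θ` to `min s R θ`. This is the one-dimensional Poincaré inequality with weight `w`
  for `φ` on a ray, stopped at `R`. The stopped function is not smooth, and is approximated
  uniformly by smooth functions whose derivative is that of `φ` times a cutoff, so that only the
  values of `w` on `(0, R]` enter (`WeightedPoincareOn.lintegral_stopped_sq_sub_le`).
* From `min s R θ` to `min s R η`. This is the Poincaré inequality on the sphere of radius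
  `min s R` (`lintegral_uniformSphere_sq_sub_le`), which costs `s ^ 2` for `s ≤ R`. For `s > R` it
  costs `R ^ 2` times the gradient on `|x| = R`, with the mass of `(R, ∞)` in front. The Hardy
  inequality with `g = 1` bounds that mass by a multiple of `R ^ n f R`, which gives the surface
  term with `c(R) = R ^ 3`.

The Poincaré inequality on the sphere, with some dimensional constant, is obtained from the
degree zero extension `x ↦ φ (x / |x|)` to the unit ball, following segments between two points.
The gradient of the extension is of order `1 / |x|`, whose square is not integrable in the plane;
but the radial projection of a segment has length at most `π`, and by Cauchy-Schwarz with respect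
to its arc length only the first power of `1 / |x|` is left (`sq_sub_le_lintegral_segment`).
-/

/-! ### Integration in polar coordinates -/

section Polar

open Metric Measure Module

variable {E : Type*} [NormedAddCommGroup E] [NormedSpace ℝ E] [FiniteDimensional ℝ E]
  [MeasurableSpace E] [BorelSpace E] [Nontrivial E] (μ : Measure E) [μ.IsAddHaarMeasure]

theorem lintegral_eq_lintegral_sphere_lintegral_Ioi {F : E → ENNReal} (hF : Measurable F) :
    ∫⁻ x, F x ∂μ = ∫⁻ θ : sphere (0 : E) 1, ∫⁻ r in Ioi (0 : ℝ),
      ENNReal.ofReal (r ^ (finrank ℝ E - 1)) * F (r • (θ : E)) ∂volume ∂μ.toSphere := by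
  have hcont : Measurable fun p : sphere (0 : E) 1 × Ioi (0 : ℝ) => F ((p.2 : ℝ) • (p.1 : E)) :=
    hF.comp (by fun_prop)
  calc ∫⁻ x, F x ∂μ = ∫⁻ x : ({0}ᶜ : Set E), F x ∂(μ.comap (↑)) := by
        rw [lintegral_subtype_comap (measurableSet_singleton _).compl, restrict_compl_singleton]
    _ = ∫⁻ p, F ((p.2 : ℝ) • (p.1 : E)) ∂(μ.toSphere.prod (volumeIoiPow (finrank ℝ E - 1))) := by
        rw [← μ.measurePreserving_homeomorphUnitSphereProd.lintegral_comp_emb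
          (Homeomorph.measurableEmbedding _)]
        refine lintegral_congr fun x => ?_
        have hx : ‖(x : E)‖ ≠ 0 := norm_ne_zero_iff.2 x.2
        simp [smul_smul, hx]
    _ = ∫⁻ θ : sphere (0 : E) 1, ∫⁻ r, F ((r : ℝ) • (θ : E)) ∂(volumeIoiPow (finrank ℝ E - 1))
          ∂μ.toSphere := by
        rw [lintegral_prod _ hcont.aemeasurable]
    _ = _ := by
        refine lintegral_congr fun θ => ?_
        rw [volumeIoiPow, lintegral_withDensity_eq_lintegral_mul]
        · simp only [Pi.mul_apply]
          rw [lintegral_subtype_comap measurableSet_Ioi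
            (fun r : ℝ => ENNReal.ofReal (r ^ (finrank ℝ E - 1)) * F (r • (θ : E)))]
        · fun_prop
        · exact hF.comp (by fun_prop)

theorem lintegral_ball_eq_lintegral_sphere_lintegral_Ioo {F : E → ENNReal} (hF : Measurable F) :
    ∫⁻ x in ball 0 1, F x ∂μ = ∫⁻ θ : sphere (0 : E) 1, ∫⁻ r in Ioo (0 : ℝ) 1,
      ENNReal.ofReal (r ^ (finrank ℝ E - 1)) * F (r • (θ : E)) ∂volume ∂μ.toSphere := by
  rw [← lintegral_indicator measurableSet_ball,
    lintegral_eq_lintegral_sphere_lintegral_Ioi μ (hF.indicator measurableSet_ball)]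
  refine lintegral_congr fun θ => ?_
  rw [← lintegral_indicator measurableSet_Ioi, ← lintegral_indicator measurableSet_Ioo]
  refine lintegral_congr fun r => ?_
  have hθ : ‖(θ : E)‖ = 1 := by simp
  by_cases hr : 0 < r
  · by_cases hr1 : r < 1
    · simp [indicator, hr, hr1, norm_smul, abs_of_pos hr]
    · simp [indicator, hr, hr1, norm_smul, abs_of_pos hr]
  · simp [indicator, hr]

/-- A degree zero homogeneous function has the same average over the unit ball as over the unit
sphere. -/
theorem lintegral_ball_comp_normalize {u : E → ENNReal} (hu : Measurable u) :
    ∫⁻ x in ball 0 1, u (‖x‖⁻¹ • x) ∂μ =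
      (finrank ℝ E : ENNReal)⁻¹ * ∫⁻ θ : sphere (0 : E) 1, u θ ∂μ.toSphere := by
  have hd : 0 < finrank ℝ E := finrank_pos
  have hI : ∫⁻ r in Ioo (0 : ℝ) 1, ENNReal.ofReal (r ^ (finrank ℝ E - 1)) =
      (finrank ℝ E : ENNReal)⁻¹ := by
    rw [← ofReal_integral_eq_lintegral_ofReal, ← integral_Ioc_eq_integral_Ioo,
      ← intervalIntegral.integral_of_le zero_le_one, integral_pow]
    · rw [← ENNReal.ofReal_natCast, ← ENNReal.ofReal_inv_of_pos (by exact_mod_cast hd),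
        Nat.sub_add_cancel hd]
      congr 1
      rw [Nat.cast_pred hd]
      simp [hd.ne']
    · exact ((continuous_pow _).integrableOn_Icc).mono_set Ioo_subset_Icc_self
    · filter_upwards [ae_restrict_mem measurableSet_Ioo] with r hr
      exact pow_nonneg hr.1.le _
  have hv : Measurable fun x : E => u (‖x‖⁻¹ • x) := hu.comp (by fun_prop)
  have hu' : Measurable fun θ : sphere (0 : E) 1 => u θ := hu.comp measurable_subtype_coe
  rw [lintegral_ball_eq_lintegral_sphere_lintegral_Ioo μ hv,
    ← lintegral_const_mul _ hu']
  refine lintegral_congr fun θ => ?_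
  have hθ : ‖(θ : E)‖ = 1 := by simp
  rw [← hI, ← lintegral_mul_const _ (by fun_prop)]
  refine setLIntegral_congr_fun measurableSet_Ioo fun r hr => ?_
  rw [norm_smul, hθ, mul_one, Real.norm_of_nonneg hr.1.le, smul_smul, inv_mul_cancel₀ hr.1.ne',
    one_smul]

end Polar

/-- The factor `σ_n` in polar coordinates is the total mass of the surface measure of the unit
sphere. -/
theorem toSphere_univ_eq_sphereArea {n : ℕ} (hn : 0 < n) :
    (volume : Measure (EuclideanSpace ℝ (Fin n))).toSphere univ =
      ENNReal.ofReal (sphereArea n) := by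
  have : Nonempty (Fin n) := ⟨⟨0, hn⟩⟩
  have hn' : (0 : ℝ) < n := by exact_mod_cast hn
  rw [Measure.toSphere_apply_univ, EuclideanSpace.volume_ball, finrank_euclideanSpace,
    Fintype.card_fin, sphereArea, ENNReal.ofReal_one, one_pow, one_mul, ← ENNReal.ofReal_natCast,
    ← ENNReal.ofReal_mul hn'.le, Real.Gamma_add_one (by positivity), Real.sqrt_eq_rpow,
    ← Real.rpow_natCast, ← Real.rpow_mul Real.pi_pos.le]
  congr 1
  have hG : Real.Gamma ((n : ℝ) / 2) ≠ 0 := (Real.Gamma_pos_of_pos (by positivity)).ne'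
  field_simp

theorem sphereArea_pos {n : ℕ} (hn : 0 < n) : 0 < sphereArea n := by
  have hn' : (0 : ℝ) < n := by exact_mod_cast hn
  have := Real.Gamma_pos_of_pos (show (0 : ℝ) < (n : ℝ) / 2 by positivity)
  unfold sphereArea
  positivity

/-! ### The Poincaré inequality on the sphere -/

section SpherePoincare

open Metric Measure Module

variable {E : Type*} [NormedAddCommGroup E] [InnerProductSpace ℝ E]

/-- A segment on a line that misses the origin is projected radially onto an arc of length at
most `π`. By Cauchy-Schwarz with respect to arc length, the squared increment of `φ (z / ‖z‖)`
along the segment is controlled with only the first power of the angular speed, which is at most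
`‖D‖ / ‖z‖`. The hypothesis says that `X` and `D` are linearly independent. -/
theorem sq_sub_le_lintegral_segment {φ : E → ℝ} (hφ : ContDiff ℝ 1 φ) {X D : E}
    (hq : 0 < ‖X‖ ^ 2 * ‖D‖ ^ 2 - inner ℝ X D ^ 2) {T : ℝ} (hT : 0 ≤ T) :
    ENNReal.ofReal ((φ (‖X + T • D‖⁻¹ • (X + T • D)) - φ (‖X‖⁻¹ • X)) ^ 2) ≤
      ENNReal.ofReal (Real.pi * ‖D‖) * ∫⁻ t in Ioc 0 T, ENNReal.ofReal
        (‖fderiv ℝ φ (‖X + t • D‖⁻¹ • (X + t • D))‖ ^ 2 / ‖X + t • D‖) := by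
  set q := ‖X‖ ^ 2 * ‖D‖ ^ 2 - inner ℝ X D ^ 2 with hqdef
  set Z : ℝ → E := fun t => X + t • D with hZdef
  set G : ℝ → ℝ := fun t => ‖fderiv ℝ φ (‖Z t‖⁻¹ • Z t)‖
  set a : ℝ → ℝ := fun t => √q / ‖Z t‖ ^ 2 with hadef
  have hs : 0 < √q := Real.sqrt_pos.2 hq
  have hss : √q ^ 2 = q := Real.sq_sqrt hq.le
  have hgram : ∀ t, ‖Z t‖ ^ 2 * ‖D‖ ^ 2 - inner ℝ (Z t) D ^ 2 = q := by
    intro t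
    simp only [hZdef, hqdef, norm_add_sq_real, inner_add_left, inner_smul_left, inner_smul_right,
      norm_smul, mul_pow, real_inner_self_eq_norm_sq, Real.norm_eq_abs, sq_abs]
    simp only [conj_trivial]
    ring
  have hZ0 : ∀ t, 0 < ‖Z t‖ := by
    intro t
    rw [norm_pos_iff]
    intro h
    have := hgram t
    rw [h] at this
    simp at this
    linarith
  have hsle : ∀ t, √q ≤ ‖Z t‖ * ‖D‖ := by
    intro t
    refine Real.sqrt_le_iff.2 ⟨by positivity, ?_⟩
    rw [mul_pow, ← hgram t]
    nlinarith [sq_nonneg (inner ℝ (Z t) D)]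
  have hZd : ∀ t, HasDerivAt Z D t := fun t => by
    have := ((hasDerivAt_id t).smul_const D).const_add X
    rwa [one_smul] at this
  have hZc : Continuous Z := by fun_prop
  have hGc : Continuous G := by
    have h1 : Continuous (fderiv ℝ φ) := hφ.continuous_fderiv (by norm_num)
    exact (h1.comp ((hZc.norm.inv₀ fun t => (hZ0 t).ne').smul hZc)).norm
  have hac : Continuous a := continuous_const.div (hZc.norm.pow 2) fun t => (pow_pos (hZ0 t) 2).ne'
  have ha0 : ∀ t, 0 ≤ a t := fun t => by positivity
  -- the angular speed `a` is the derivative of an arctangent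
  have hA : ∀ t, HasDerivAt (fun t => Real.arctan (inner ℝ (Z t) D / √q)) (a t) t := by
    intro t
    have h1 : HasDerivAt (fun t => inner ℝ (Z t) D / √q) (‖D‖ ^ 2 / √q) t := by
      have := ((hZd t).inner ℝ (hasDerivAt_const t D)).div_const (√q)
      simpa [real_inner_self_eq_norm_sq] using this
    convert h1.arctan using 1
    have h2 := hgram t
    have h3 := hZ0 t
    have h4 : 1 + (inner ℝ (Z t) D / √q) ^ 2 = ‖Z t‖ ^ 2 * ‖D‖ ^ 2 / q := by
      rw [div_pow, hss, ← h2]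
      rw [← h2] at hq
      field_simp
      ring
    have hD : 0 < ‖D‖ := by
      rw [norm_pos_iff]
      rintro rfl
      simp [hqdef] at hq
    rw [h4, hadef]
    simp only
    field_simp
    rw [hss]
  -- the derivative of the radial projection
  have hu : ∀ t, ∃ v : E, HasDerivAt (fun t => ‖Z t‖⁻¹ • Z t) v t ∧ ‖v‖ ≤ a t := by
    intro t
    have h3 := hZ0 t
    have hn : HasDerivAt (fun t => ‖Z t‖) (inner ℝ (Z t) D / ‖Z t‖) t := by
      have h1 := (hZd t).norm_sq.sqrt (pow_pos h3 2).ne'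
      simp only [Real.sqrt_sq (norm_nonneg _)] at h1
      convert h1 using 1
      field_simp
    refine ⟨_, (hn.inv h3.ne').smul (hZd t), ?_⟩
    refine abs_le_of_sq_le_sq' ?_ (ha0 t) |>.2
    rw [norm_add_sq_real]
    simp only [Pi.inv_apply, norm_smul, inner_smul_left, inner_smul_right, conj_trivial, mul_pow,
      Real.norm_eq_abs, sq_abs, hadef, real_inner_comm, div_pow, hss]
    rw [← hgram t, real_inner_comm]
    field_simp
    apply le_of_eq
    ring
  -- `c` optimizes the inequality `2 c F' ≤ G ^ 2 a + c ^ 2 a`, whose integrated form is `hΨ` below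
  set c := (φ (‖Z T‖⁻¹ • Z T) - φ (‖Z 0‖⁻¹ • Z 0)) / Real.pi with hc
  have hJc : Continuous fun t => G t ^ 2 * a t := (hGc.pow 2).mul hac
  have hJ : ∀ t, HasDerivAt (fun t => ∫ s in (0 : ℝ)..t, G s ^ 2 * a s) (G t ^ 2 * a t) t :=
    fun t => intervalIntegral.integral_hasDerivAt_right (hJc.intervalIntegrable _ _)
      (hJc.stronglyMeasurableAtFilter _ _) hJc.continuousAt
  have hΨ : Antitone fun t => 2 * c * φ (‖Z t‖⁻¹ • Z t) - (∫ s in (0 : ℝ)..t, G s ^ 2 * a s) -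
      c ^ 2 * Real.arctan (inner ℝ (Z t) D / √q) := by
    choose v hv hva using hu
    have hF : ∀ t, HasDerivAt (fun t => φ (‖Z t‖⁻¹ • Z t))
        (fderiv ℝ φ (‖Z t‖⁻¹ • Z t) (v t)) t := fun t =>
      ((hφ.differentiable (by norm_num) _).hasFDerivAt.comp_hasDerivAt t (hv t))
    refine antitone_of_hasDerivAt_nonpos
      (fun t => (((hF t).const_mul (2 * c)).sub (hJ t)).sub ((hA t).const_mul (c ^ 2)))
      fun t => ?_
    have h1 : |fderiv ℝ φ (‖Z t‖⁻¹ • Z t) (v t)| ≤ G t * a t :=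
      ((fderiv ℝ φ (‖Z t‖⁻¹ • Z t)).le_opNorm (v t)).trans
        (mul_le_mul_of_nonneg_left (hva t) (norm_nonneg _))
    have h2 : 2 * c * fderiv ℝ φ (‖Z t‖⁻¹ • Z t) (v t) ≤ 2 * |c| * (G t * a t) := by
      calc _ ≤ |2 * c * fderiv ℝ φ (‖Z t‖⁻¹ • Z t) (v t)| := le_abs_self _
        _ = 2 * |c| * |fderiv ℝ φ (‖Z t‖⁻¹ • Z t) (v t)| := by rw [abs_mul, abs_mul]; simp
        _ ≤ _ := by gcongr
    have h3 := mul_nonneg (ha0 t) (sq_nonneg (G t - |c|))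
    show 2 * c * _ - _ - c ^ 2 * _ ≤ 0
    have h4 : a t * (G t - |c|) ^ 2 = G t ^ 2 * a t - 2 * |c| * (G t * a t) + c ^ 2 * a t := by
      rw [← sq_abs c]; ring
    linarith
  have hmono := hΨ hT
  simp only [intervalIntegral.integral_same, sub_zero] at hmono
  have hpi := Real.pi_pos
  have hA1 := Real.arctan_lt_pi_div_two (inner ℝ (Z T) D / √q)
  have hA2 := Real.neg_pi_div_two_lt_arctan (inner ℝ (Z 0) D / √q)
  have hΔ : φ (‖Z T‖⁻¹ • Z T) - φ (‖Z 0‖⁻¹ • Z 0) = c * Real.pi := by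
    rw [hc]; field_simp
  have hkey : c ^ 2 * Real.pi ≤ ∫ s in (0 : ℝ)..T, G s ^ 2 * a s := by
    have h5 : c ^ 2 * (Real.arctan (inner ℝ (Z T) D / √q) - Real.arctan (inner ℝ (Z 0) D / √q)) ≤
        c ^ 2 * Real.pi := by gcongr; linarith
    have h6 : 2 * c * φ (‖Z T‖⁻¹ • Z T) - 2 * c * φ (‖Z 0‖⁻¹ • Z 0) = 2 * (c ^ 2 * Real.pi) := by
      rw [← mul_sub, hΔ]; ring
    linarith
  have hQc : Continuous fun t => G t ^ 2 / ‖Z t‖ := (hGc.pow 2).div hZc.norm fun t => (hZ0 t).ne'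
  have hle : (∫ s in (0 : ℝ)..T, G s ^ 2 * a s) ≤ ‖D‖ * ∫ s in (0 : ℝ)..T, G s ^ 2 / ‖Z s‖ := by
    rw [← intervalIntegral.integral_const_mul]
    refine intervalIntegral.integral_mono_on hT (hJc.intervalIntegrable _ _)
      ((hQc.const_mul _).intervalIntegrable _ _) fun t _ => ?_
    have h3 := hZ0 t
    rw [hadef]
    simp only
    rw [mul_div_assoc', mul_div_assoc', div_le_div_iff₀ (by positivity) (by positivity)]
    have := mul_le_mul_of_nonneg_left (hsle t) (show 0 ≤ G t ^ 2 * ‖Z t‖ by positivity)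
    nlinarith
  have hreal : (φ (‖Z T‖⁻¹ • Z T) - φ (‖Z 0‖⁻¹ • Z 0)) ^ 2 ≤
      Real.pi * ‖D‖ * ∫ s in (0 : ℝ)..T, G s ^ 2 / ‖Z s‖ := by
    rw [hΔ]
    have := mul_le_mul_of_nonneg_left (hkey.trans hle) hpi.le
    nlinarith
  have hZX : Z 0 = X := by simp [hZdef]
  rw [hZX] at hreal
  refine (ENNReal.ofReal_le_ofReal hreal).trans ?_
  rw [ENNReal.ofReal_mul (by positivity), intervalIntegral.integral_of_le hT,
    ofReal_integral_eq_lintegral_ofReal]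
  · exact (hQc.intervalIntegrable 0 T).1
  · exact Filter.Eventually.of_forall fun t => by positivity

variable [FiniteDimensional ℝ E] [MeasurableSpace E] [BorelSpace E]

theorem lintegral_ball_comp_segment_le (μ : Measure E) [μ.IsAddHaarMeasure] {Q : E → ENNReal}
    (hQ : Measurable Q) {y : E} (hy : y ∈ ball (0 : E) 1) {t : ℝ} (ht0 : 0 ≤ t)
    (ht : t ≤ 1 / 2) :
    ∫⁻ x in ball 0 1, Q (x + t • (y - x)) ∂μ ≤
      2 ^ finrank ℝ E * ∫⁻ x in ball 0 1, Q x ∂μ := by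
  have h1t : 0 < 1 - t := by linarith
  set Q' : E → ENNReal := (ball (0 : E) 1).indicator Q with hQ'
  have hQ'm : Measurable Q' := hQ.indicator measurableSet_ball
  have hmem : ∀ x ∈ ball (0 : E) 1, x + t • (y - x) ∈ ball (0 : E) 1 := fun x hx =>
    (convex_ball (0 : E) 1).add_smul_sub_mem hx hy ⟨ht0, by linarith⟩
  calc ∫⁻ x in ball 0 1, Q (x + t • (y - x)) ∂μ
      = ∫⁻ x in ball 0 1, Q' (x + t • (y - x)) ∂μ := by
        refine setLIntegral_congr_fun measurableSet_ball fun x hx => ?_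
        simp only [hQ', indicator_of_mem (hmem x hx)]
    _ ≤ ∫⁻ x, Q' (x + t • (y - x)) ∂μ := setLIntegral_le_lintegral _ _
    _ = ∫⁻ x, Q' ((1 - t) • x + t • y) ∂μ := by
        refine lintegral_congr fun x => ?_
        congr 1
        module
    _ = ENNReal.ofReal (|((1 - t) ^ finrank ℝ E)⁻¹|) * ∫⁻ x, Q' (x + t • y) ∂μ := by
        rw [← smul_eq_mul, ← lintegral_smul_measure, ← Measure.map_addHaar_smul μ h1t.ne',
          lintegral_map]
        · exact hQ'm.comp (by fun_prop)
        · fun_prop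
    _ = ENNReal.ofReal (|((1 - t) ^ finrank ℝ E)⁻¹|) * ∫⁻ x, Q' x ∂μ := by
        rw [lintegral_add_right_eq_self]
    _ ≤ 2 ^ finrank ℝ E * ∫⁻ x, Q' x ∂μ := by
        gcongr
        rw [abs_of_pos (by positivity), ← inv_pow,
          show (2 : ENNReal) ^ finrank ℝ E = ENNReal.ofReal (2 ^ finrank ℝ E) by
            rw [ENNReal.ofReal_pow (by norm_num)]; simp]
        refine ENNReal.ofReal_le_ofReal (pow_le_pow_left₀ (by positivity) ?_ _)
        rw [inv_le_comm₀ h1t (by norm_num)]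
        linarith
    _ = _ := by rw [hQ', lintegral_indicator measurableSet_ball]

theorem ae_gram_pos (μ : Measure E) [μ.IsAddHaarMeasure] (hd : 2 ≤ finrank ℝ E) {y : E}
    (hy : y ≠ 0) : ∀ᵐ x ∂μ, 0 < ‖x‖ ^ 2 * ‖y - x‖ ^ 2 - inner ℝ x (y - x) ^ 2 := by
  have hne : (Submodule.span ℝ {y}) ≠ ⊤ := by
    intro h
    have := finrank_span_singleton (K := ℝ) hy
    rw [h, finrank_top] at this
    omega
  have h0 := Measure.addHaar_submodule μ _ hne
  filter_upwards [measure_eq_zero_iff_ae_notMem.1 h0] with x hx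
  have hlt : ‖inner ℝ x (y - x)‖ < ‖x‖ * ‖y - x‖ := by
    refine lt_of_le_of_ne (norm_inner_le_norm _ _) fun h => hx ?_
    by_cases hx0 : x = 0
    · simp [hx0]
    by_cases hxy : y - x = 0
    · rw [← sub_eq_zero.1 hxy]
      exact Submodule.mem_span_singleton_self y
    obtain ⟨r, -, hyx⟩ := (norm_inner_eq_norm_iff hx0 hxy).1 h
    have hyx' : y = (1 + r) • x := by rw [← sub_add_cancel y x, hyx]; module
    have hr : 1 + r ≠ 0 := by
      intro h0
      rw [h0, zero_smul] at hyx'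
      exact hy hyx'
    refine Submodule.mem_span_singleton.2 ⟨(1 + r)⁻¹, ?_⟩
    rw [hyx', smul_smul, inv_mul_cancel₀ hr, one_smul]
  have := pow_lt_pow_left₀ hlt (norm_nonneg _) two_ne_zero
  rw [Real.norm_eq_abs, sq_abs, mul_pow] at this
  linarith

/-- Comparison of the radial projection of `φ` at the two ends of the half segment from a point
of the unit ball to the midpoint with another one. -/
theorem lintegral_ball_sq_sub_midpoint_le (μ : Measure E) [μ.IsAddHaarMeasure]
    (hd : 2 ≤ finrank ℝ E) {φ : E → ℝ} (hφ : ContDiff ℝ 1 φ) {h : E → ℝ}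
    (hh : h = fun x => φ (‖x‖⁻¹ • x)) :
    ∫⁻ y in ball 0 1, ∫⁻ x in ball 0 1,
        ENNReal.ofReal ((h (x + (1 / 2 : ℝ) • (y - x)) - h x) ^ 2) ∂μ ∂μ ≤
      ENNReal.ofReal Real.pi * 2 ^ finrank ℝ E *
        (∫⁻ θ : sphere (0 : E) 1, ENNReal.ofReal (‖fderiv ℝ φ θ‖ ^ 2) ∂μ.toSphere) *
        μ (ball 0 1) := by
  have : Nontrivial E := Module.nontrivial_of_finrank_pos (R := ℝ) (by omega)
  set d := finrank ℝ E
  set Q : E → ENNReal := fun z => ENNReal.ofReal (‖fderiv ℝ φ (‖z‖⁻¹ • z)‖ ^ 2 / ‖z‖) with hQ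
  have hfm : Measurable (fderiv ℝ φ) := (hφ.continuous_fderiv (by norm_num)).measurable
  have hQm : Measurable Q := by
    have : Measurable fun z : E => fderiv ℝ φ (‖z‖⁻¹ • z) := hfm.comp (by fun_prop)
    fun_prop
  set β := μ.restrict (ball (0 : E) 1) with hβ
  set I := ∫⁻ x, Q x ∂β with hI
  set J := ∫⁻ θ : sphere (0 : E) 1, ENNReal.ofReal (‖fderiv ℝ φ θ‖ ^ 2) ∂μ.toSphere
  have hIJ : I ≤ J := by
    rw [hI, hβ, lintegral_ball_eq_lintegral_sphere_lintegral_Ioo μ hQm]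
    refine lintegral_mono fun θ => ?_
    have hθ : ‖(θ : E)‖ = 1 := by simp
    calc _ ≤ ∫⁻ r in Ioo (0 : ℝ) 1, ENNReal.ofReal (‖fderiv ℝ φ θ‖ ^ 2) := by
          refine setLIntegral_mono measurable_const fun r hr => ?_
          simp only [hQ]
          rw [norm_smul, hθ, mul_one, Real.norm_of_nonneg hr.1.le, smul_smul,
            inv_mul_cancel₀ hr.1.ne', one_smul, ← ENNReal.ofReal_mul (pow_nonneg hr.1.le _)]
          refine ENNReal.ofReal_le_ofReal ?_
          -- here the dimension has to be at least two
          have hr1 : r ^ (finrank ℝ E - 1) ≤ r :=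
            pow_le_of_le_one hr.1.le hr.2.le (by omega)
          rw [mul_div_assoc', div_le_iff₀ hr.1, mul_comm]
          gcongr
      _ = _ := by simp
  have hhalf : ∀ᵐ y ∂β, ∫⁻ x, ENNReal.ofReal ((h (x + (1 / 2 : ℝ) • (y - x)) - h x) ^ 2) ∂β ≤
      ENNReal.ofReal Real.pi * 2 ^ d * I := by
    have hy0 : ∀ᵐ y ∂β, y ≠ 0 := ae_restrict_of_ae (Measure.ae_ne μ 0)
    filter_upwards [hy0, ae_restrict_mem measurableSet_ball] with y hy hyB
    have hjoint : Measurable fun p : E × ℝ => Q (p.1 + p.2 • (y - p.1)) := hQm.comp (by fun_prop)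
    calc _ ≤ ∫⁻ x, ENNReal.ofReal (2 * Real.pi) * ∫⁻ t in Ioc (0 : ℝ) (1 / 2),
            Q (x + t • (y - x)) ∂volume ∂β := by
          refine lintegral_mono_ae ?_
          filter_upwards [ae_restrict_of_ae (ae_gram_pos μ hd hy),
            ae_restrict_mem measurableSet_ball] with x hx hxB
          simp only [hh]
          refine (sq_sub_le_lintegral_segment hφ hx (T := 1 / 2) (by norm_num)).trans ?_
          rw [mul_comm (2 : ℝ)]
          gcongr
          have h1 := norm_sub_le y x
          rw [mem_ball_zero_iff] at hxB hyB
          linarith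
      _ = ENNReal.ofReal (2 * Real.pi) * ∫⁻ t in Ioc (0 : ℝ) (1 / 2), ∫⁻ x,
            Q (x + t • (y - x)) ∂β := by
          rw [lintegral_const_mul _ hjoint.lintegral_prod_right',
            lintegral_lintegral_swap hjoint.aemeasurable]
      _ ≤ ENNReal.ofReal (2 * Real.pi) * ∫⁻ t in Ioc (0 : ℝ) (1 / 2), 2 ^ d * I := by
          refine mul_le_mul' le_rfl ?_
          refine setLIntegral_mono measurable_const fun t ht => ?_
          exact lintegral_ball_comp_segment_le μ hQm hyB ht.1.le ht.2
      _ = _ := by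
          rw [setLIntegral_const, Real.volume_Ioc, sub_zero, mul_comm (2 ^ d * I), ← mul_assoc,
            ← ENNReal.ofReal_mul (by positivity), mul_assoc (ENNReal.ofReal _)]
          congr 2
          ring
  calc _ ≤ ∫⁻ y, ENNReal.ofReal Real.pi * 2 ^ d * I ∂β := lintegral_mono_ae hhalf
    _ = ENNReal.ofReal Real.pi * 2 ^ d * I * μ (ball 0 1) := by simp [hβ]
    _ ≤ _ := by gcongr

/-- Poincaré inequality on the unit sphere, in terms of independent copies, with a dimensional
constant. The increment of the radial projection of `φ` between two points of the unit ball
is split at their midpoint. -/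
theorem lintegral_sphere_sq_sub_le (μ : Measure E) [μ.IsAddHaarMeasure] (hd : 2 ≤ finrank ℝ E)
    {φ : E → ℝ} (hφ : ContDiff ℝ 1 φ) :
    ∫⁻ η : sphere (0 : E) 1, ∫⁻ θ : sphere (0 : E) 1, ENNReal.ofReal ((φ θ - φ η) ^ 2)
        ∂μ.toSphere ∂μ.toSphere ≤
      4 * ENNReal.ofReal Real.pi * 2 ^ finrank ℝ E * finrank ℝ E * μ.toSphere univ *
        ∫⁻ θ : sphere (0 : E) 1, ENNReal.ofReal (‖fderiv ℝ φ θ‖ ^ 2) ∂μ.toSphere := by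
  have : Nontrivial E := Module.nontrivial_of_finrank_pos (R := ℝ) (by omega)
  set d := finrank ℝ E
  set h : E → ℝ := fun x => φ (‖x‖⁻¹ • x) with hh
  have hhm : Measurable h := hφ.continuous.measurable.comp (by fun_prop)
  have hHle := lintegral_ball_sq_sub_midpoint_le μ hd hφ hh
  set β := μ.restrict (ball (0 : E) 1)
  set J := ∫⁻ θ : sphere (0 : E) 1, ENNReal.ofReal (‖fderiv ℝ φ θ‖ ^ 2) ∂μ.toSphere
  have hmeas : Measurable fun p : E × E =>
      ENNReal.ofReal ((h (p.2 + (1 / 2 : ℝ) • (p.1 - p.2)) - h p.2) ^ 2) := by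
    have h1 : Measurable fun p : E × E => h (p.2 + (1 / 2 : ℝ) • (p.1 - p.2)) :=
      hhm.comp (by fun_prop)
    have h2 : Measurable fun p : E × E => h p.2 := hhm.comp measurable_snd
    fun_prop
  have hmeas' : Measurable fun p : E × E =>
      ENNReal.ofReal ((h (p.1 + (1 / 2 : ℝ) • (p.2 - p.1)) - h p.1) ^ 2) := by
    have h1 : Measurable fun p : E × E => h (p.1 + (1 / 2 : ℝ) • (p.2 - p.1)) :=
      hhm.comp (by fun_prop)
    have h2 : Measurable fun p : E × E => h p.1 := hhm.comp measurable_fst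
    fun_prop
  set H := ∫⁻ y, ∫⁻ x, ENNReal.ofReal ((h (x + (1 / 2 : ℝ) • (y - x)) - h x) ^ 2) ∂β ∂β with hH
  have hball : ∫⁻ y, ∫⁻ x, ENNReal.ofReal ((h x - h y) ^ 2) ∂β ∂β ≤ 4 * H := by
    calc _ ≤ ∫⁻ y, ∫⁻ x, 2 * ENNReal.ofReal ((h (x + (1 / 2 : ℝ) • (y - x)) - h x) ^ 2) +
            2 * ENNReal.ofReal ((h (y + (1 / 2 : ℝ) • (x - y)) - h y) ^ 2) ∂β ∂β := by
          refine lintegral_mono fun y => lintegral_mono fun x => ?_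
          have hm : y + (1 / 2 : ℝ) • (x - y) = x + (1 / 2 : ℝ) • (y - x) := by module
          rw [hm, ← ENNReal.ofReal_ofNat, ← ENNReal.ofReal_mul (by norm_num),
            ← ENNReal.ofReal_mul (by norm_num), ← ENNReal.ofReal_add (by positivity)
              (by positivity)]
          refine ENNReal.ofReal_le_ofReal ?_
          nlinarith [sq_nonneg (h x + h y - 2 * h (x + (1 / 2 : ℝ) • (y - x)))]
      _ = 2 * H + 2 * ∫⁻ y, ∫⁻ x,
            ENNReal.ofReal ((h (y + (1 / 2 : ℝ) • (x - y)) - h y) ^ 2) ∂β ∂β := by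
          have e : ∀ y, ∫⁻ x, 2 * ENNReal.ofReal ((h (x + (1 / 2 : ℝ) • (y - x)) - h x) ^ 2) +
              2 * ENNReal.ofReal ((h (y + (1 / 2 : ℝ) • (x - y)) - h y) ^ 2) ∂β =
              2 * ∫⁻ x, ENNReal.ofReal ((h (x + (1 / 2 : ℝ) • (y - x)) - h x) ^ 2) ∂β +
              2 * ∫⁻ x, ENNReal.ofReal ((h (y + (1 / 2 : ℝ) • (x - y)) - h y) ^ 2) ∂β := by
            intro y
            have m1 := hmeas.comp (measurable_prodMk_left (x := y))
            have m2 := hmeas'.comp (measurable_prodMk_left (x := y))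
            simp only [Function.comp_def] at m1 m2
            rw [lintegral_add_left (m1.const_mul 2), lintegral_const_mul _ m1,
              lintegral_const_mul _ m2]
          simp only [e]
          rw [lintegral_add_left (hmeas.lintegral_prod_right'.const_mul 2),
            lintegral_const_mul _ hmeas.lintegral_prod_right',
            lintegral_const_mul _ hmeas'.lintegral_prod_right']
      _ = 4 * H := by
          rw [lintegral_lintegral_swap hmeas'.aemeasurable, ← hH, ← add_mul]
          norm_num
  have hsph : ∫⁻ y, ∫⁻ x, ENNReal.ofReal ((h x - h y) ^ 2) ∂β ∂β =
      (d : ENNReal)⁻¹ * ((d : ENNReal)⁻¹ * ∫⁻ η : sphere (0 : E) 1, ∫⁻ θ : sphere (0 : E) 1,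
        ENNReal.ofReal ((φ θ - φ η) ^ 2) ∂μ.toSphere ∂μ.toSphere) := by
    have hφm := hφ.continuous.measurable
    have m1 : Measurable fun y : E => ∫⁻ θ : sphere (0 : E) 1, ENNReal.ofReal ((φ θ - φ y) ^ 2)
        ∂μ.toSphere := by
      have : Measurable fun p : E × sphere (0 : E) 1 =>
          ENNReal.ofReal ((φ p.2 - φ p.1) ^ 2) := by
        have h1 : Measurable fun p : E × sphere (0 : E) 1 => φ p.2 := hφm.comp (by fun_prop)
        have h2 : Measurable fun p : E × sphere (0 : E) 1 => φ p.1 := hφm.comp (by fun_prop)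
        fun_prop
      exact this.lintegral_prod_right'
    have e1 : ∀ y, ∫⁻ x, ENNReal.ofReal ((h x - h y) ^ 2) ∂β = (d : ENNReal)⁻¹ *
        ∫⁻ θ : sphere (0 : E) 1, ENNReal.ofReal ((φ θ - h y) ^ 2) ∂μ.toSphere := fun y =>
      lintegral_ball_comp_normalize μ (u := fun x => ENNReal.ofReal ((φ x - h y) ^ 2))
        (by fun_prop)
    simp only [e1]
    rw [lintegral_const_mul]
    · congr 1
      exact lintegral_ball_comp_normalize μ m1
    · exact m1.comp (by fun_prop)
  have hd0 : (d : ENNReal) ≠ 0 := by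
    have : d ≠ 0 := by omega
    exact_mod_cast this
  have hdt : (d : ENNReal) ≠ ⊤ := ENNReal.natCast_ne_top d
  set S := ∫⁻ η : sphere (0 : E) 1, ∫⁻ θ : sphere (0 : E) 1,
    ENNReal.ofReal ((φ θ - φ η) ^ 2) ∂μ.toSphere ∂μ.toSphere
  calc S = d * (d * ((d : ENNReal)⁻¹ * ((d : ENNReal)⁻¹ * S))) := by
        rw [← mul_assoc (d : ENNReal) (d : ENNReal)⁻¹, ENNReal.mul_inv_cancel hd0 hdt, one_mul,
          ← mul_assoc, ENNReal.mul_inv_cancel hd0 hdt, one_mul]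
    _ ≤ d * (d * (4 * (ENNReal.ofReal Real.pi * 2 ^ d * J * μ (ball 0 1)))) := by
        rw [← hsph]
        gcongr
        exact hball.trans (by gcongr)
    _ = _ := by
        rw [toSphere_apply_univ]
        ring

end SpherePoincare

/-! ### The radial inequality outside the ball -/

theorem IsRadialSteadyState.hasDerivAt {n : ℕ} (hn : 0 < n) {K f : ℝ → ℝ}
    (h : IsRadialSteadyState n K f) {r : ℝ} (hr : 0 < r) :
    HasDerivAt (fun s => K s * f s) (-(r * f r)) r := by
  set e : EuclideanSpace ℝ (Fin n) := EuclideanSpace.single ⟨0, hn⟩ 1 with he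
  have hnorm : ‖e‖ = 1 := by simp [he]
  have hre : ‖r • e‖ = r := by rw [norm_smul, hnorm, mul_one, Real.norm_of_nonneg hr.le]
  have h1 : HasDerivAt (fun s : ℝ => s • e) e r := by
    have := (hasDerivAt_id r).smul_const e
    rwa [one_smul] at this
  have h2 := (h (r • e)).hasFDerivAt.comp_hasDerivAt r h1
  have h3 : HasDerivAt (fun s => K ‖s • e‖ * f ‖s • e‖) (-(r * f r)) r := by
    refine h2.congr_deriv ?_
    rw [InnerProductSpace.toDual_apply_apply, hre, inner_neg_left, inner_smul_left,
      inner_smul_left, real_inner_self_eq_norm_sq, hnorm]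
    simp only [conj_trivial]
    ring
  refine h3.congr_of_eventuallyEq ?_
  filter_upwards [lt_mem_nhds hr] with s hs
  rw [norm_smul, hnorm, mul_one, Real.norm_of_nonneg hs.le]

/-- Hardy type inequality on the half line `(R, ∞)`, by integration of the derivative of
`g ^ 2 * r ^ (n - 2) * K * f`: the density `f` is, up to the factor `-r`, the derivative of
`K * f`, and the smallness of `K / r ^ 2` absorbs the derivative of the power. -/
theorem lintegral_Ioi_sq_le {n : ℕ} (hn : 2 ≤ n) {K f : ℝ → ℝ} {R : ℝ} (hR : 0 < R)
    (hf : ∀ r, 0 ≤ r → 0 ≤ f r) (hK : ∀ r, 0 ≤ r → 0 ≤ K r)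
    (hKf : ∀ r, 0 < r → HasDerivAt (fun s => K s * f s) (-(r * f r)) r)
    (hKR : ∀ r, R ≤ r → ((n : ℝ) - 1) * (K r / r ^ 2) ≤ 1 / 2)
    (hint : IntegrableOn (fun r => r ^ (n - 1) * f r) (Ioi 0)) {g g' : ℝ → ℝ}
    (hg : ∀ r, HasDerivAt g (g' r) r) (hg' : Continuous g') :
    ∫⁻ r in Ioi R, ENNReal.ofReal (g r ^ 2 * (r ^ (n - 1) * f r)) ≤
      8 * (∫⁻ r in Ioi R, ENNReal.ofReal (K r * g' r ^ 2 * (r ^ (n - 1) * f r))) +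
        ENNReal.ofReal (2 * g R ^ 2 * (R ^ n * f R)) := by
  obtain ⟨m, rfl⟩ : ∃ m, n = m + 2 := ⟨n - 2, by omega⟩
  simp only [show m + 2 - 1 = m + 1 by omega] at hint ⊢
  have hK2 : ∀ r, R ≤ r → (m + 1) * K r ≤ r ^ 2 / 2 := by
    intro r hr
    have h := hKR r hr
    have hr0 : 0 < r := hR.trans_le hr
    rw [mul_div_assoc', div_le_iff₀ (by positivity)] at h
    push_cast at h
    linarith
  have hgc : Continuous g := continuous_iff_continuousAt.2 fun r => (hg r).continuousAt
  set P : ℝ → ℝ := fun r => g r ^ 2 * r ^ m * (K r * f r) with hP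
  set P' : ℝ → ℝ := fun r => (2 * g r * g' r * r ^ m + g r ^ 2 * (m * r ^ (m - 1))) *
    (K r * f r) - g r ^ 2 * (r ^ (m + 1) * f r) with hP'
  have hPd : ∀ r, 0 < r → HasDerivAt P (P' r) r := by
    intro r hr
    refine ((((hg r).pow 2).mul (hasDerivAt_pow m r)).mul (hKf r hr)).congr_deriv ?_
    simp only [hP', Pi.mul_apply, Pi.pow_apply]
    ring
  have hPle : ∀ r, R ≤ r → P' r ≤ 2 * (g' r ^ 2 * r ^ (m + 1) * (K r * f r)) -
      1 / 4 * (g r ^ 2 * (r ^ (m + 1) * f r)) := by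
    intro r hr
    have hr0 : 0 < r := hR.trans_le hr
    have hK0 := hK r hr0.le
    have hf0 := hf r hr0.le
    have h2 := hK2 r hr
    have hK1 : K r ≤ r ^ 2 / 2 := by nlinarith [mul_nonneg (Nat.cast_nonneg (α := ℝ) m) hK0]
    have hm : m * r ^ (m - 1) * K r ≤ r ^ (m + 1) / 2 := by
      rcases m with _ | k
      · simp only [Nat.cast_zero, zero_mul]
        positivity
      · have h3 : ((k + 1 : ℕ) : ℝ) * K r ≤ r ^ 2 / 2 := by linarith
        have h4 := mul_le_mul_of_nonneg_left h3 (pow_nonneg hr0.le k)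
        calc _ = r ^ k * (((k + 1 : ℕ) : ℝ) * K r) := by rw [Nat.add_sub_cancel]; ring
          _ ≤ _ := h4
          _ = _ := by ring
    have h5 : 2 * g r * g' r * r ^ m * K r ≤
        1 / 4 * (g r ^ 2 * r ^ (m + 1)) + 2 * (g' r ^ 2 * r ^ (m + 1) * K r) := by
      -- `2 a b ≤ a ^ 2 + b ^ 2` with `a = g r / 2` and `b = 2 g' K`, then `2 K ≤ r ^ 2`
      have h6 : 2 * g r * g' r * K r * r ≤
          1 / 4 * (g r ^ 2 * r ^ 2) + 2 * (g' r ^ 2 * r ^ 2 * K r) := by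
        nlinarith [sq_nonneg (g r * r / 2 - 2 * g' r * K r),
          mul_nonneg (mul_nonneg (sq_nonneg (g' r)) hK0) (sub_nonneg.2 hK1)]
      have h7 := mul_le_mul_of_nonneg_left h6 (show 0 ≤ r ^ m / r by positivity)
      have e1 : r ^ m / r * (2 * g r * g' r * K r * r) = 2 * g r * g' r * r ^ m * K r := by
        field_simp
      have e2 : r ^ m / r * (1 / 4 * (g r ^ 2 * r ^ 2) + 2 * (g' r ^ 2 * r ^ 2 * K r)) =
          1 / 4 * (g r ^ 2 * r ^ (m + 1)) + 2 * (g' r ^ 2 * r ^ (m + 1) * K r) := by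
        field_simp
        ring
      rwa [e1, e2] at h7
    have h8 : g r ^ 2 * (m * r ^ (m - 1) * K r) ≤ g r ^ 2 * (r ^ (m + 1) / 2) := by gcongr
    have h9 := mul_le_mul_of_nonneg_right (add_le_add h5 h8) hf0
    simp only [hP']
    linarith
  have hsub : ∀ {T}, R ≤ T → uIcc R T ⊆ Ioi 0 := by
    intro T hT r hr
    rw [uIcc_of_le hT] at hr
    exact hR.trans_le hr.1
  have hKfc : ∀ {T}, R ≤ T → ContinuousOn (fun r => K r * f r) (uIcc R T) := fun hT r hr =>
    (hKf r (hsub hT hr)).continuousAt.continuousWithinAt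
  have hI0 : ∀ {T}, R ≤ T → IntervalIntegrable (fun r => r ^ (m + 1) * f r) volume R T :=
    fun hT => (hint.mono_set (hsub hT)).intervalIntegrable
  have hI1 : ∀ {T}, R ≤ T →
      IntervalIntegrable (fun r => g r ^ 2 * (r ^ (m + 1) * f r)) volume R T := fun hT =>
    (hI0 hT).continuousOn_mul (hgc.pow 2).continuousOn
  have hI2 : ∀ {T}, R ≤ T →
      IntervalIntegrable (fun r => g' r ^ 2 * r ^ (m + 1) * (K r * f r)) volume R T := fun hT =>
    (ContinuousOn.mul (by fun_prop) (hKfc hT)).intervalIntegrable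
  have hreal : ∀ T, R ≤ T → ∫ r in R..T, g r ^ 2 * (r ^ (m + 1) * f r) ≤
      8 * (∫ r in R..T, g' r ^ 2 * r ^ (m + 1) * (K r * f r)) +
        2 * g R ^ 2 * (R ^ (m + 2) * f R) := by
    intro T hT
    have hI3 : IntervalIntegrable P' volume R T :=
      (ContinuousOn.mul (by fun_prop) (hKfc hT)).intervalIntegrable.sub (hI1 hT)
    have hftc : ∫ r in R..T, P' r = P T - P R :=
      intervalIntegral.integral_eq_sub_of_hasDerivAt (fun r hr => hPd r (hsub hT hr)) hI3
    have hmono : ∫ r in R..T, P' r ≤ ∫ r in R..T,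
        (2 * (g' r ^ 2 * r ^ (m + 1) * (K r * f r)) - 1 / 4 * (g r ^ 2 * (r ^ (m + 1) * f r))) :=
      intervalIntegral.integral_mono_on hT hI3 (((hI2 hT).const_mul 2).sub ((hI1 hT).const_mul _))
        fun r hr => hPle r hr.1
    rw [intervalIntegral.integral_sub ((hI2 hT).const_mul 2) ((hI1 hT).const_mul _),
      intervalIntegral.integral_const_mul, intervalIntegral.integral_const_mul, hftc] at hmono
    have hT0 : 0 ≤ T := hR.le.trans hT
    have hPT : 0 ≤ P T :=
      mul_nonneg (by positivity) (mul_nonneg (hK T hT0) (hf T hT0))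
    have hPR : P R ≤ g R ^ 2 * (R ^ (m + 2) * f R) / 2 := by
      have h2 := hK2 R le_rfl
      have hK1 : K R ≤ R ^ 2 / 2 := by
        nlinarith [mul_nonneg (Nat.cast_nonneg (α := ℝ) m) (hK R hR.le)]
      have := mul_le_mul_of_nonneg_left hK1
        (mul_nonneg (mul_nonneg (sq_nonneg (g R)) (pow_nonneg hR.le m)) (hf R hR.le))
      calc P R = g R ^ 2 * R ^ m * f R * K R := by simp only [hP]; ring
        _ ≤ _ := this
        _ = _ := by ring
    linarith
  have hset : ⋃ k : ℕ, Ioc R (R + k) = Ioi R := by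
    ext r
    simp only [mem_iUnion, mem_Ioc, mem_Ioi]
    refine ⟨fun ⟨_, h, _⟩ => h, fun h => ?_⟩
    obtain ⟨k, hk⟩ := exists_nat_ge (r - R)
    exact ⟨k, h, by linarith⟩
  have hdir : Directed (· ⊆ ·) fun k : ℕ => Ioc R (R + k) := by
    refine Monotone.directed_le fun i j hij => Ioc_subset_Ioc_right ?_
    have : (i : ℝ) ≤ j := by exact_mod_cast hij
    linarith
  conv_lhs => rw [← hset, setLIntegral_iUnion_of_directed _ hdir]
  refine iSup_le fun k => ?_
  have hT : R ≤ R + (k : ℝ) := by simp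
  have h0 : ∀ r ∈ Ioc R (R + k), 0 ≤ r := fun r hr => (hR.trans hr.1).le
  rw [← ofReal_integral_eq_lintegral_ofReal (hI1 hT).1, ← intervalIntegral.integral_of_le hT]
  · refine (ENNReal.ofReal_le_ofReal (hreal _ hT)).trans ?_
    refine ENNReal.ofReal_add_le.trans ?_
    gcongr
    rw [ENNReal.ofReal_mul (by norm_num), intervalIntegral.integral_of_le hT,
      ofReal_integral_eq_lintegral_ofReal (hI2 hT).1]
    · refine mul_le_mul' (ENNReal.ofReal_ofNat 8).le ?_
      · rw [← hset]
        exact (lintegral_mono_set (subset_iUnion (fun k : ℕ => Ioc R (R + (k : ℝ))) k)).trans_eq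
          (lintegral_congr fun r => by congr 1; ring)
    · filter_upwards [ae_restrict_mem measurableSet_Ioc] with r hr
      have := hf r (h0 r hr)
      have := hK r (h0 r hr)
      have := h0 r hr
      positivity
  · filter_upwards [ae_restrict_mem measurableSet_Ioc] with r hr
    have := hf r (h0 r hr)
    have := h0 r hr
    positivity

/-! ### The radial inequality inside the ball -/

/-- Smooth functions whose derivative is cut off at `R` approximate uniformly a smooth function
stopped at `R`. -/
theorem exists_contDiff_approx_stopped {F : ℝ → ℝ} (hF : ContDiff ℝ ∞ F) {M : ℝ}
    (hM : ∀ r, |deriv F r| ≤ M) {R δ : ℝ} (hR : 0 < R) (hδ : 0 < δ) :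
    ∃ ψ : ℝ → ℝ, ContDiff ℝ ∞ ψ ∧ (∀ r, 0 ≤ r → |ψ r - F (min r R)| ≤ δ) ∧
      (∀ r, deriv ψ r ^ 2 ≤ deriv F r ^ 2) ∧ ∀ r, R ≤ r → deriv ψ r = 0 := by
  have hM0 : 0 ≤ M := (abs_nonneg _).trans (hM 0)
  obtain ⟨ε, hε, hεR, hεδ⟩ : ∃ ε, 0 < ε ∧ ε ≤ R ∧ 2 * M * ε ≤ δ := by
    refine ⟨min R (δ / (2 * M + 1)), lt_min hR (by positivity), min_le_left _ _, ?_⟩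
    calc 2 * M * min R (δ / (2 * M + 1)) ≤ 2 * M * (δ / (2 * M + 1)) := by
          gcongr; exact min_le_right _ _
      _ = δ * (2 * M / (2 * M + 1)) := by ring
      _ ≤ δ * 1 := by
          gcongr
          rw [div_le_one (by positivity)]
          linarith
      _ = δ := mul_one δ
  set χ : ℝ → ℝ := fun s => Real.smoothTransition ((R - s) / ε)
  have hχs : ContDiff ℝ ∞ χ := Real.smoothTransition.contDiff.comp (by fun_prop)
  have hχ0 : ∀ s, 0 ≤ χ s := fun s => Real.smoothTransition.nonneg _
  have hχ1 : ∀ s, χ s ≤ 1 := fun s => Real.smoothTransition.le_one _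
  have hχR : ∀ s, R ≤ s → χ s = 0 := fun s hs =>
    Real.smoothTransition.zero_of_nonpos (div_nonpos_of_nonpos_of_nonneg (by linarith) hε.le)
  have hχε : ∀ s, s ≤ R - ε → χ s = 1 := fun s hs =>
    Real.smoothTransition.one_of_one_le ((one_le_div hε).2 (by linarith))
  have hF' : ContDiff ℝ ∞ (deriv F) := (contDiff_infty_iff_deriv.1 hF).2
  have hk : ContDiff ℝ ∞ fun s => deriv F s * χ s := hF'.mul hχs
  have hkc := hk.continuous
  set ψ : ℝ → ℝ := fun r => F 0 + ∫ s in (0 : ℝ)..r, deriv F s * χ s with hψ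
  have hψd : ∀ r, HasDerivAt ψ (deriv F r * χ r) r := fun r =>
    (intervalIntegral.integral_hasDerivAt_right (hkc.intervalIntegrable _ _)
      (hkc.stronglyMeasurableAtFilter _ _) hkc.continuousAt).const_add _
  have hψ' : deriv ψ = fun r => deriv F r * χ r := funext fun r => (hψd r).deriv
  refine ⟨ψ, contDiff_infty_iff_deriv.2 ⟨fun r => (hψd r).differentiableAt, hψ' ▸ hk⟩, ?_, ?_, ?_⟩
  · intro r hr
    set a := min r R with ha
    set b := min r (R - ε) with hb
    have hb0 : 0 ≤ b := le_min hr (by linarith)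
    have hba : b ≤ a := min_le_min_left _ (by linarith)
    have hab : a - b ≤ ε := by
      rw [ha, hb]
      rcases min_cases r R with h | h <;> rcases min_cases r (R - ε) with h' | h' <;> linarith
    have hFd : ∀ s, HasDerivAt F (deriv F s) s := fun s =>
      (hF.differentiable (by simp) s).hasDerivAt
    have h1 : ∫ s in (0 : ℝ)..b, deriv F s * χ s = F b - F 0 := by
      rw [← intervalIntegral.integral_eq_sub_of_hasDerivAt (fun s _ => hFd s)
        (hF'.continuous.intervalIntegrable _ _)]
      refine intervalIntegral.integral_congr fun s hs => ?_
      rw [uIcc_of_le hb0] at hs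
      simp [hχε s (hs.2.trans (min_le_right _ _))]
    have h3 : ∫ s in a..r, deriv F s * χ s = 0 := by
      rcases le_total r R with h | h
      · rw [ha, min_eq_left h, intervalIntegral.integral_same]
      · refine (intervalIntegral.integral_congr (g := fun _ => (0 : ℝ)) fun s hs => ?_).trans
          (by simp)
        rw [uIcc_of_le (min_le_left _ _), ha, min_eq_right h] at hs
        simp [hχR s hs.1]
    have h2 : ‖∫ s in b..a, deriv F s * χ s‖ ≤ M * |a - b| := by
      refine intervalIntegral.norm_integral_le_of_norm_le_const fun s _ => ?_
      rw [Real.norm_eq_abs, abs_mul, abs_of_nonneg (hχ0 s)]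
      exact (mul_le_of_le_one_right (abs_nonneg _) (hχ1 s)).trans (hM s)
    have h4 : |F b - F a| ≤ M * |a - b| := by
      have := Convex.norm_image_sub_le_of_norm_hasDerivWithin_le (f := F) (s := univ)
        (fun s _ => (hFd s).hasDerivWithinAt) (fun s _ => hM s) convex_univ
        (mem_univ a) (mem_univ b)
      rwa [Real.norm_eq_abs, Real.norm_eq_abs, abs_sub_comm b a] at this
    have hsum : ψ r - F a = (F b - F a) + ∫ s in b..a, deriv F s * χ s := by
      have hi : ∀ x y, IntervalIntegrable (fun s => deriv F s * χ s) volume x y :=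
        fun x y => hkc.intervalIntegrable x y
      simp only [hψ]
      rw [← intervalIntegral.integral_add_adjacent_intervals (hi 0 b) (hi b r),
        ← intervalIntegral.integral_add_adjacent_intervals (hi b a) (hi a r), h1, h3]
      ring
    rw [hsum]
    refine (abs_add_le _ _).trans ?_
    rw [Real.norm_eq_abs] at h2
    rw [abs_of_nonneg (sub_nonneg.2 hba)] at h2 h4
    have : M * (a - b) ≤ M * ε := by gcongr
    linarith
  · intro r
    rw [hψ']
    simp only
    rw [mul_pow]
    exact mul_le_of_le_one_right (sq_nonneg _) (pow_le_one₀ (hχ0 r) (hχ1 r))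
  · intro r hr
    rw [hψ']
    simp [hχR r hr]

/-- The one-dimensional Poincaré inequality for a function stopped at `R`, which is not smooth,
in terms of two independent copies. -/
theorem WeightedPoincareOn.lintegral_stopped_sq_sub_le {p w : ℝ → ℝ}
    (hP : WeightedPoincareOn (Ioi 0) p w) (hpm : Measurable p) (hp0 : ∀ r, 0 < r → 0 ≤ p r)
    (hp1 : ∫⁻ r in Ioi 0, ENNReal.ofReal (p r) = 1) (hw : ∀ r, 0 < r → 0 ≤ w r)
    {F : ℝ → ℝ} (hF : ContDiff ℝ ∞ F) {M : ℝ} (hFM : ∀ r, |F r| ≤ M)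
    (hM : ∀ r, |deriv F r| ≤ M) {R : ℝ} (hR : 0 < R) {ν : Measure ℝ}
    (hν : ν = (volume.restrict (Ioi 0)).withDensity fun r => ENNReal.ofReal (p r)) :
    ∫⁻ r, ∫⁻ s, ENNReal.ofReal ((F (min r R) - F (min s R)) ^ 2) ∂ν ∂ν ≤
      6 * ∫⁻ r in Ioc 0 R, ENNReal.ofReal (w r * deriv F r ^ 2 * p r) := by
  have hprob : ν univ = 1 := by rw [hν, withDensity_apply _ .univ, setLIntegral_univ, hp1]
  have hν0 : ∀ᵐ r ∂ν, 0 < r := by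
    rw [hν]
    exact (withDensity_absolutelyContinuous _ _).ae_le (ae_restrict_mem measurableSet_Ioi)
  have hpi : IntegrableOn p (Ioi 0) := by
    refine ⟨hpm.aestronglyMeasurable, ?_⟩
    rw [hasFiniteIntegral_iff_ofReal (by
      filter_upwards [ae_restrict_mem measurableSet_Ioi] with r hr using hp0 r hr), hp1]
    exact ENNReal.one_lt_top
  refine ENNReal.le_of_forall_pos_le_add fun ε hε _ => ?_
  obtain ⟨δ, hδ, hδε⟩ : ∃ δ : ℝ, 0 < δ ∧ 12 * δ ^ 2 ≤ ε := by
    refine ⟨√(ε / 12), by positivity, ?_⟩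
    rw [Real.sq_sqrt (by positivity)]
    linarith
  obtain ⟨ψ, hψ, hψF, hψ', hψR⟩ := exists_contDiff_approx_stopped hF hM hR hδ
  have hψb : ∀ r, 0 < r → |ψ r| ≤ M + δ := by
    intro r hr
    have h1 := hψF r hr.le
    have h2 := hFM (min r R)
    have h3 := abs_add_le (ψ r - F (min r R)) (F (min r R))
    rw [sub_add_cancel] at h3
    linarith
  set m := ∫ y in Ioi 0, ψ y * p y
  have hψm : Measurable fun r => ENNReal.ofReal ((ψ r - m) ^ 2) := by
    have := hψ.continuous.measurable
    fun_prop
  -- the inequality for the smooth approximation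
  have hvar : ∫⁻ r, ENNReal.ofReal ((ψ r - m) ^ 2) ∂ν ≤
      ∫⁻ r in Ioc 0 R, ENNReal.ofReal (w r * deriv F r ^ 2 * p r) := by
    have hint : IntegrableOn (fun r => (ψ r - m) ^ 2 * p r) (Ioi 0) := by
      refine hpi.bdd_mul (c := (M + δ + |m|) ^ 2)
        (by have := hψ.continuous; fun_prop) ?_
      filter_upwards [ae_restrict_mem measurableSet_Ioi] with r hr
      rw [norm_pow, Real.norm_eq_abs]
      have := hψb r hr
      have := abs_sub (ψ r) m
      gcongr
      linarith
    calc ∫⁻ r, ENNReal.ofReal ((ψ r - m) ^ 2) ∂ν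
        = ∫⁻ r in Ioi 0, ENNReal.ofReal ((ψ r - m) ^ 2 * p r) := by
          rw [hν, lintegral_withDensity_eq_lintegral_mul _ (by fun_prop) hψm]
          refine lintegral_congr fun r => ?_
          rw [Pi.mul_apply, mul_comm, ← ENNReal.ofReal_mul (sq_nonneg _)]
      _ = ENNReal.ofReal (∫ r in Ioi 0, (ψ r - m) ^ 2 * p r) := by
          rw [ofReal_integral_eq_lintegral_ofReal hint]
          filter_upwards [ae_restrict_mem measurableSet_Ioi] with r hr
          exact mul_nonneg (sq_nonneg _) (hp0 r hr)
      _ ≤ ∫⁻ r in Ioi 0, ENNReal.ofReal (w r * deriv ψ r ^ 2 * p r) :=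
          hP ψ hψ.contDiffOn ⟨M + δ, hψb⟩
      _ ≤ ∫⁻ r in Ioi 0, (Ioc 0 R).indicator
            (fun r => ENNReal.ofReal (w r * deriv F r ^ 2 * p r)) r := by
          refine setLIntegral_mono' measurableSet_Ioi fun r (hr : 0 < r) => ?_
          rcases le_or_gt r R with hrR | hrR
          · rw [indicator_of_mem (show r ∈ Ioc 0 R from ⟨hr, hrR⟩)]
            have := hw r hr
            have := hp0 r hr
            have := hψ' r
            gcongr
          · simp [hψR r hrR.le]
      _ = _ := by
          rw [setLIntegral_indicator measurableSet_Ioc]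
          congr 2
          exact inter_eq_left.2 Ioc_subset_Ioi_self
  calc ∫⁻ r, ∫⁻ s, ENNReal.ofReal ((F (min r R) - F (min s R)) ^ 2) ∂ν ∂ν
      ≤ ∫⁻ r, ∫⁻ s, (3 * ENNReal.ofReal ((ψ r - m) ^ 2) + 3 * ENNReal.ofReal ((ψ s - m) ^ 2) +
          ε) ∂ν ∂ν := by
        refine lintegral_mono_ae ?_
        filter_upwards [hν0] with r hr
        refine lintegral_mono_ae ?_
        filter_upwards [hν0] with s hs
        rw [← ENNReal.ofReal_ofNat, ← ENNReal.ofReal_mul (by norm_num),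
          ← ENNReal.ofReal_mul (by norm_num), ← ENNReal.ofReal_coe_nnreal,
          ← ENNReal.ofReal_add (by positivity) (by positivity),
          ← ENNReal.ofReal_add (by positivity) (by positivity)]
        refine ENNReal.ofReal_le_ofReal ?_
        have h1 := abs_le.1 (hψF r hr.le)
        have h2 := abs_le.1 (hψF s hs.le)
        set e := (F (min r R) - F (min s R)) - (ψ r - ψ s) with he
        have he2 : e ^ 2 ≤ (2 * δ) ^ 2 := by
          apply sq_le_sq' <;> linarith
        have e1 : F (min r R) - F (min s R) = (ψ r - m) - (ψ s - m) + e := by rw [he]; ring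
        rw [e1]
        nlinarith [sq_nonneg ((ψ r - m) + (ψ s - m)), sq_nonneg ((ψ r - m) - e),
          sq_nonneg ((ψ s - m) + e)]
    _ = 3 * (∫⁻ r, ENNReal.ofReal ((ψ r - m) ^ 2) ∂ν) +
          3 * (∫⁻ r, ENNReal.ofReal ((ψ r - m) ^ 2) ∂ν) + ε := by
        have e : ∀ r, ∫⁻ s, (3 * ENNReal.ofReal ((ψ r - m) ^ 2) +
            3 * ENNReal.ofReal ((ψ s - m) ^ 2) + (ε : ENNReal)) ∂ν =
            3 * ENNReal.ofReal ((ψ r - m) ^ 2) +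
            (3 * (∫⁻ r, ENNReal.ofReal ((ψ r - m) ^ 2) ∂ν) + ε) := by
          intro r
          rw [lintegral_add_right _ measurable_const, lintegral_add_left measurable_const,
            lintegral_const_mul _ hψm, lintegral_const, lintegral_const, hprob, mul_one, mul_one,
            add_assoc]
        simp only [e]
        rw [lintegral_add_right _ measurable_const, lintegral_const_mul _ hψm, lintegral_const,
          hprob, mul_one, add_assoc]
    _ ≤ _ := by
        rw [← add_mul]
        gcongr
        norm_num

/-! ### The law of the radius and the direction -/

open Metric in
/-- The uniform probability measure on the unit sphere of `ℝⁿ`. -/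
noncomputable def uniformSphere (n : ℕ) : Measure (sphere (0 : EuclideanSpace ℝ (Fin n)) 1) :=
  (ENNReal.ofReal (sphereArea n))⁻¹ • (volume : Measure (EuclideanSpace ℝ (Fin n))).toSphere

/-- The law of `|X|` when `X` has density `x ↦ f |x|` on `ℝⁿ`. -/
noncomputable def radialLaw (n : ℕ) (f : ℝ → ℝ) : Measure ℝ :=
  (volume.restrict (Ioi 0)).withDensity
    fun r => ENNReal.ofReal (sphereArea n * r ^ (n - 1) * f r)

/-- The probability measure on `ℝⁿ` with density `x ↦ f |x|`. -/
noncomputable def radialMeasure (n : ℕ) (f : ℝ → ℝ) : Measure (EuclideanSpace ℝ (Fin n)) :=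
  volume.withDensity fun x => ENNReal.ofReal (f ‖x‖)

section Law

open Metric

variable {n : ℕ} {f : ℝ → ℝ}

theorem isProbabilityMeasure_uniformSphere (hn : 0 < n) :
    IsProbabilityMeasure (uniformSphere n) := by
  refine ⟨?_⟩
  rw [uniformSphere, Measure.smul_apply, toSphere_univ_eq_sphereArea hn, smul_eq_mul,
    ENNReal.inv_mul_cancel _ ENNReal.ofReal_ne_top]
  exact (ENNReal.ofReal_pos.2 (sphereArea_pos hn)).ne'

theorem toSphere_eq_smul_uniformSphere (hn : 0 < n) :
    (volume : Measure (EuclideanSpace ℝ (Fin n))).toSphere =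
      ENNReal.ofReal (sphereArea n) • uniformSphere n := by
  rw [uniformSphere, smul_smul, ENNReal.mul_inv_cancel _ ENNReal.ofReal_ne_top, one_smul]
  exact (ENNReal.ofReal_pos.2 (sphereArea_pos hn)).ne'

theorem lintegral_radialLaw (hf : Measurable f) {g : ℝ → ENNReal} (hg : Measurable g) :
    ∫⁻ r, g r ∂(radialLaw n f) =
      ∫⁻ r in Ioi 0, g r * ENNReal.ofReal (sphereArea n * r ^ (n - 1) * f r) := by
  rw [radialLaw, lintegral_withDensity_eq_lintegral_mul _ (by fun_prop) hg]
  exact lintegral_congr fun r => mul_comm _ _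

theorem lintegral_eq_lintegral_uniformSphere (hn : 0 < n)
    {G : EuclideanSpace ℝ (Fin n) → ENNReal} (hG : Measurable G) :
    ∫⁻ x, G x = ∫⁻ θ, ∫⁻ r in Ioi (0 : ℝ),
      ENNReal.ofReal (sphereArea n * r ^ (n - 1)) * G (r • (θ : EuclideanSpace ℝ (Fin n)))
        ∂volume ∂(uniformSphere n) := by
  have : Nonempty (Fin n) := ⟨⟨0, hn⟩⟩
  have hσ := sphereArea_pos hn
  rw [lintegral_eq_lintegral_sphere_lintegral_Ioi volume hG, finrank_euclideanSpace,
    Fintype.card_fin, toSphere_eq_smul_uniformSphere hn, lintegral_smul_measure, smul_eq_mul,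
    ← lintegral_const_mul' _ _ ENNReal.ofReal_ne_top]
  refine lintegral_congr fun θ => ?_
  rw [← lintegral_const_mul' _ _ ENNReal.ofReal_ne_top]
  refine lintegral_congr fun r => ?_
  rw [← mul_assoc, ← ENNReal.ofReal_mul hσ.le]

theorem lintegral_radialMeasure (hn : 0 < n) (hf : Measurable f)
    {G : EuclideanSpace ℝ (Fin n) → ENNReal} (hG : Measurable G) :
    ∫⁻ x, G x ∂(radialMeasure n f) =
      ∫⁻ θ, ∫⁻ r, G (r • (θ : EuclideanSpace ℝ (Fin n))) ∂(radialLaw n f)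
        ∂(uniformSphere n) := by
  have hσ := sphereArea_pos hn
  rw [radialMeasure, lintegral_withDensity_eq_lintegral_mul _ (by fun_prop) hG,
    lintegral_eq_lintegral_uniformSphere hn (by fun_prop)]
  refine lintegral_congr fun θ => ?_
  have hθ : ‖(θ : EuclideanSpace ℝ (Fin n))‖ = 1 := by simp
  have hGθ : Measurable fun r : ℝ => G (r • (θ : EuclideanSpace ℝ (Fin n))) :=
    hG.comp (by fun_prop)
  rw [lintegral_radialLaw hf hGθ]
  refine setLIntegral_congr_fun measurableSet_Ioi fun r (hr : 0 < r) => ?_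
  simp only [Pi.mul_apply]
  rw [norm_smul, hθ, mul_one, Real.norm_of_nonneg hr.le, ← mul_assoc,
    ← ENNReal.ofReal_mul (by positivity), mul_comm]

theorem IsRadialProbDensity.isProbabilityMeasure (h : IsRadialProbDensity n f) :
    IsProbabilityMeasure (radialMeasure n f) := by
  refine ⟨?_⟩
  rw [radialMeasure, withDensity_apply _ .univ, setLIntegral_univ, h.lintegral_eq_one]

theorem IsRadialProbDensity.isProbabilityMeasure_radialLaw (hn : 0 < n)
    (h : IsRadialProbDensity n f) : IsProbabilityMeasure (radialLaw n f) := by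
  have := isProbabilityMeasure_uniformSphere hn
  have := h.isProbabilityMeasure
  refine ⟨?_⟩
  have h1 := lintegral_radialMeasure hn h.measurable (G := fun _ => 1) measurable_const
  simpa using h1.symm

end Law

/-- The variance is half the mean square of the difference of two independent copies; the factor
`1 / 2` is dropped. -/
theorem ofReal_variance_le_lintegral_sq_sub {Ω : Type*} [MeasurableSpace Ω] {P : Measure Ω}
    [IsProbabilityMeasure P] {X : Ω → ℝ} (hX : Measurable X) {M : ℝ} (hM : ∀ x, |X x| ≤ M) :
    ENNReal.ofReal ((∫ x, X x ^ 2 ∂P) - (∫ x, X x ∂P) ^ 2) ≤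
      ∫⁻ x, ∫⁻ y, ENNReal.ofReal ((X x - X y) ^ 2) ∂P ∂P := by
  have hi : Integrable X P := .of_bound hX.aestronglyMeasurable M (.of_forall hM)
  have hi2 : Integrable (fun x => X x ^ 2) P :=
    .of_bound (by fun_prop) (M ^ 2) (.of_forall fun x => by
      rw [norm_pow]; exact pow_le_pow_left₀ (norm_nonneg _) (hM x) 2)
  set a := ∫ x, X x ∂P with ha
  set q := ∫ x, X x ^ 2 ∂P with hq
  have hquad : ∀ b c : ℝ, Integrable (fun y => X y ^ 2 - b * X y + c) P ∧
      ∫ y, (X y ^ 2 - b * X y + c) ∂P = q - b * a + c := by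
    intro b c
    have h1 : Integrable (fun y => X y ^ 2 - b * X y) P := hi2.sub (hi.const_mul b)
    refine ⟨h1.add (integrable_const c), ?_⟩
    rw [integral_add h1 (integrable_const c), integral_sub hi2 (hi.const_mul b),
      integral_const_mul]
    simp [ha, hq]
  have e : ∀ x, (fun y => (X x - X y) ^ 2) = fun y => X y ^ 2 - 2 * X x * X y + X x ^ 2 :=
    fun x => funext fun y => by ring
  have hinner : ∀ x, ∫⁻ y, ENNReal.ofReal ((X x - X y) ^ 2) ∂P =
      ENNReal.ofReal (X x ^ 2 - 2 * a * X x + q) := by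
    intro x
    rw [← ofReal_integral_eq_lintegral_ofReal (e x ▸ (hquad _ _).1)
      (.of_forall fun y => sq_nonneg _), e, (hquad _ _).2]
    congr 1
    ring
  have hq0 : a ^ 2 ≤ q := by
    have h1 : 0 ≤ ∫ y, (X y ^ 2 - 2 * a * X y + a ^ 2) ∂P :=
      integral_nonneg fun y => by
        show 0 ≤ X y ^ 2 - 2 * a * X y + a ^ 2
        nlinarith [sq_nonneg (X y - a)]
    rw [(hquad _ _).2] at h1
    nlinarith
  simp only [hinner]
  rw [← ofReal_integral_eq_lintegral_ofReal (hquad _ _).1, (hquad _ _).2]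
  · exact ENNReal.ofReal_le_ofReal (by nlinarith)
  · exact .of_forall fun x => by
      show 0 ≤ X x ^ 2 - 2 * a * X x + q
      nlinarith [sq_nonneg (X x - a)]

section Law

open Metric

variable {n : ℕ} {f : ℝ → ℝ}

/-- The Poincaré inequality on the sphere of radius `r`. -/
theorem lintegral_uniformSphere_sq_sub_le (hn : 2 ≤ n) {φ : EuclideanSpace ℝ (Fin n) → ℝ}
    (hφ : ContDiff ℝ 1 φ) (r : ℝ) :
    ∫⁻ θ, ∫⁻ η, ENNReal.ofReal ((φ (r • (θ : EuclideanSpace ℝ (Fin n))) -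
        φ (r • (η : EuclideanSpace ℝ (Fin n)))) ^ 2) ∂(uniformSphere n) ∂(uniformSphere n) ≤
      ENNReal.ofReal (4 * Real.pi * 2 ^ n * n) * ∫⁻ θ, ENNReal.ofReal
        (r ^ 2 * ‖fderiv ℝ φ (r • (θ : EuclideanSpace ℝ (Fin n)))‖ ^ 2) ∂(uniformSphere n) := by
  have hn0 : 0 < n := by omega
  have hφr : ContDiff ℝ 1 fun x => φ (r • x) := hφ.comp (contDiff_const_smul r)
  have hmain := lintegral_sphere_sq_sub_le volume (by simpa using hn) hφr
  rw [toSphere_univ_eq_sphereArea hn0, finrank_euclideanSpace, Fintype.card_fin] at hmain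
  have hs0 : ENNReal.ofReal (sphereArea n) ≠ 0 :=
    (ENNReal.ofReal_pos.2 (sphereArea_pos hn0)).ne'
  set s := ENNReal.ofReal (sphereArea n) with hs
  have hst : s ≠ ⊤ := ENNReal.ofReal_ne_top
  have hsi : s⁻¹ ≠ ⊤ := ENNReal.inv_ne_top.2 hs0
  have hder : ∀ x, ‖fderiv ℝ (fun x => φ (r • x)) x‖ ^ 2 = r ^ 2 * ‖fderiv ℝ φ (r • x)‖ ^ 2 := by
    intro x
    rw [fderiv_comp_smul, norm_smul, mul_pow, Real.norm_eq_abs, sq_abs]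
  simp only [hder] at hmain
  have hC : 4 * ENNReal.ofReal Real.pi * 2 ^ n * n = ENNReal.ofReal (4 * Real.pi * 2 ^ n * n) := by
    rw [ENNReal.ofReal_mul (by positivity), ENNReal.ofReal_mul (by positivity),
      ENNReal.ofReal_mul (by positivity), ENNReal.ofReal_pow (by norm_num)]
    simp
  rw [hC] at hmain
  simp only [uniformSphere, lintegral_smul_measure, smul_eq_mul, ← hs]
  rw [lintegral_const_mul' _ _ hsi]
  set T := ∫⁻ η : sphere (0 : EuclideanSpace ℝ (Fin n)) 1, ENNReal.ofReal
    (r ^ 2 * ‖fderiv ℝ φ (r • (η : EuclideanSpace ℝ (Fin n)))‖ ^ 2)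
      ∂(volume : Measure (EuclideanSpace ℝ (Fin n))).toSphere
  set C := ENNReal.ofReal (4 * Real.pi * 2 ^ n * n)
  calc _ ≤ s⁻¹ * (s⁻¹ * (C * s * T)) := by
        gcongr
        refine le_trans (le_of_eq ?_) hmain
        refine lintegral_congr fun θ => lintegral_congr fun η => ?_
        rw [← neg_sub, neg_sq]
    _ = (s⁻¹ * s) * (C * (s⁻¹ * T)) := by ring
    _ = _ := by rw [ENNReal.inv_mul_cancel hs0 hst, one_mul]

theorem lintegral_surfaceMeasure (hn : 0 < n) {R : ℝ} {G : EuclideanSpace ℝ (Fin n) → ENNReal}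
    (hG : Measurable G) :
    ∫⁻ x, G x ∂(surfaceMeasure n R) = ENNReal.ofReal (R ^ (n - 1)) *
      (ENNReal.ofReal (sphereArea n) *
        ∫⁻ θ, G (R • (θ : EuclideanSpace ℝ (Fin n))) ∂(uniformSphere n)) := by
  rw [surfaceMeasure, lintegral_smul_measure, lintegral_map hG (by fun_prop),
    toSphere_eq_smul_uniformSphere hn, lintegral_smul_measure]
  rfl

end Law

/-! ### Assembling the hybrid inequality -/

section Ray

variable {E : Type*} [NormedAddCommGroup E] [NormedSpace ℝ E] {φ : E → ℝ} {v : E}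

theorem hasDerivAt_comp_smul_right (hφ : ContDiff ℝ ∞ φ) (v : E) (r : ℝ) :
    HasDerivAt (fun s : ℝ => φ (s • v)) (fderiv ℝ φ (r • v) v) r := by
  have h := (hasDerivAt_id r).smul_const v
  rw [one_smul] at h
  exact (hφ.differentiable (by simp) (r • v)).hasFDerivAt.comp_hasDerivAt r h

theorem abs_fderiv_apply_le (hv : ‖v‖ = 1) (x : E) : |fderiv ℝ φ x v| ≤ ‖fderiv ℝ φ x‖ := by
  have := (fderiv ℝ φ x).le_opNorm v
  rwa [hv, mul_one] at this

end Ray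

/-- Comparison of two independent points, with directions in `S` and radii on the line, through
the points stopped at radius `R`: first along the rays, then by the stopped radii at a common
direction, then by the directions at a common stopped radius. -/
theorem lintegral_sq_sub_le_stopped {S : Type*} [TopologicalSpace S] [SecondCountableTopology S]
    [MeasurableSpace S] [BorelSpace S] {u : S × ℝ → ℝ} (huc : Continuous u) (R : ℝ)
    (μ : Measure S) [IsProbabilityMeasure μ] (ν : Measure ℝ) [IsProbabilityMeasure ν] :
    ∫⁻ θ, ∫⁻ r, ∫⁻ η, ∫⁻ s, ENNReal.ofReal ((u (θ, r) - u (η, s)) ^ 2) ∂ν ∂μ ∂ν ∂μ ≤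
      4 * (2 * (∫⁻ θ, ∫⁻ r, ENNReal.ofReal ((u (θ, r) - u (θ, min r R)) ^ 2) ∂ν ∂μ) +
        (∫⁻ θ, ∫⁻ r, ∫⁻ s, ENNReal.ofReal ((u (θ, min r R) - u (θ, min s R)) ^ 2) ∂ν ∂ν ∂μ) +
        ∫⁻ s, ∫⁻ θ, ∫⁻ η, ENNReal.ofReal ((u (θ, min s R) - u (η, min s R)) ^ 2) ∂μ ∂μ ∂ν) := by
  set u' : S × ℝ → ℝ := fun z => u (z.1, min z.2 R)
  have hu'c : Continuous u' := huc.comp (by fun_prop)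
  set A : S × ℝ → ENNReal := fun z => ENNReal.ofReal ((u z - u' z) ^ 2) with hA
  have hAm : Measurable A := by
    have : Continuous A := ENNReal.continuous_ofReal.comp (by fun_prop)
    exact this.measurable
  set B : (S × ℝ) × (S × ℝ) → ENNReal :=
    fun q => ENNReal.ofReal ((u' q.1 - u' (q.1.1, q.2.2)) ^ 2) with hB
  have hBm : Measurable B := by
    have h1 : Continuous fun q : (S × ℝ) × (S × ℝ) => u' (q.1.1, q.2.2) := hu'c.comp (by fun_prop)
    have : Continuous B := ENNReal.continuous_ofReal.comp (by fun_prop)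
    exact this.measurable
  set D : (S × ℝ) × (S × ℝ) → ENNReal :=
    fun q => ENNReal.ofReal ((u' (q.1.1, q.2.2) - u' q.2) ^ 2) with hD
  have hDm : Measurable D := by
    have h1 : Continuous fun q : (S × ℝ) × (S × ℝ) => u' (q.1.1, q.2.2) := hu'c.comp (by fun_prop)
    have : Continuous D := ENNReal.continuous_ofReal.comp (by fun_prop)
    exact this.measurable
  have hGm : Measurable fun q : (S × ℝ) × (S × ℝ) => ENNReal.ofReal ((u q.1 - u q.2) ^ 2) := by
    have : Continuous fun q : (S × ℝ) × (S × ℝ) => ENNReal.ofReal ((u q.1 - u q.2) ^ 2) :=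
      ENNReal.continuous_ofReal.comp (by fun_prop)
    exact this.measurable
  set P := μ.prod ν with hP
  have hAP : ∫⁻ z, A z ∂P = ∫⁻ θ, ∫⁻ r, A (θ, r) ∂ν ∂μ := lintegral_prod _ hAm.aemeasurable
  have hLHS : ∫⁻ z, ∫⁻ z', ENNReal.ofReal ((u z - u z') ^ 2) ∂P ∂P =
      ∫⁻ θ, ∫⁻ r, ∫⁻ η, ∫⁻ s, ENNReal.ofReal ((u (θ, r) - u (η, s)) ^ 2) ∂ν ∂μ ∂ν ∂μ := by
    rw [hP, lintegral_prod _ hGm.lintegral_prod_right'.aemeasurable]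
    refine lintegral_congr fun θ => lintegral_congr fun r => ?_
    have h1 : Measurable fun z' => ENNReal.ofReal ((u (θ, r) - u z') ^ 2) :=
      hGm.comp measurable_prodMk_left
    rw [lintegral_prod _ h1.aemeasurable]
  have hBP : ∫⁻ z, ∫⁻ z', B (z, z') ∂P ∂P =
      ∫⁻ θ, ∫⁻ r, ∫⁻ s, ENNReal.ofReal ((u' (θ, r) - u' (θ, s)) ^ 2) ∂ν ∂ν ∂μ := by
    rw [hP, lintegral_prod _ hBm.lintegral_prod_right'.aemeasurable]
    refine lintegral_congr fun θ => lintegral_congr fun r => ?_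
    have h1 : Measurable fun z' => B ((θ, r), z') := hBm.comp measurable_prodMk_left
    rw [lintegral_prod _ h1.aemeasurable]
    simp [hB]
  have hDP : ∫⁻ z, ∫⁻ z', D (z, z') ∂P ∂P =
      ∫⁻ s, ∫⁻ θ, ∫⁻ η, ENNReal.ofReal ((u' (θ, s) - u' (η, s)) ^ 2) ∂μ ∂μ ∂ν := by
    have h1 : ∀ θ r, ∫⁻ z', D ((θ, r), z') ∂P =
        ∫⁻ s, ∫⁻ η, ENNReal.ofReal ((u' (θ, s) - u' (η, s)) ^ 2) ∂μ ∂ν := by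
      intro θ r
      have h1 : Measurable fun z' => D ((θ, r), z') := hDm.comp measurable_prodMk_left
      rw [hP, lintegral_prod_symm _ h1.aemeasurable]
    rw [hP, lintegral_prod _ hDm.lintegral_prod_right'.aemeasurable]
    simp only [← hP, h1, lintegral_const, measure_univ, mul_one]
    refine lintegral_lintegral_swap ?_
    have h2 : Measurable fun q : (S × ℝ) × S =>
        ENNReal.ofReal ((u' q.1 - u' (q.2, q.1.2)) ^ 2) := by
      have h1 : Continuous fun q : (S × ℝ) × S => u' (q.2, q.1.2) := hu'c.comp (by fun_prop)
      have : Continuous fun q : (S × ℝ) × S =>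
          ENNReal.ofReal ((u' q.1 - u' (q.2, q.1.2)) ^ 2) :=
        ENNReal.continuous_ofReal.comp (by fun_prop)
      exact this.measurable
    exact h2.lintegral_prod_right'.aemeasurable
  calc _ = ∫⁻ z, ∫⁻ z', ENNReal.ofReal ((u z - u z') ^ 2) ∂P ∂P := hLHS.symm
    _ ≤ ∫⁻ z, ∫⁻ z', 4 * (A z + (B (z, z') + (D (z, z') + A z'))) ∂P ∂P := by
        refine lintegral_mono fun z => lintegral_mono fun z' => ?_
        simp only [hA, hB, hD]
        rw [← ENNReal.ofReal_add (by positivity) (by positivity),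
          ← ENNReal.ofReal_add (by positivity) (by positivity),
          ← ENNReal.ofReal_add (by positivity) (by positivity), ← ENNReal.ofReal_ofNat,
          ← ENNReal.ofReal_mul (by norm_num)]
        refine ENNReal.ofReal_le_ofReal ?_
        generalize u' (z.1, z'.2) = y
        have h1 := sq_nonneg ((u z - u' z) - (u' z - y))
        have h2 := sq_nonneg ((u z - u' z) - (y - u' z'))
        have h3 := sq_nonneg ((u z - u' z) + (u z' - u' z'))
        have h4 := sq_nonneg ((u' z - y) - (y - u' z'))
        have h5 := sq_nonneg ((u' z - y) + (u z' - u' z'))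
        have h6 := sq_nonneg ((y - u' z') + (u z' - u' z'))
        nlinarith
    _ = 4 * ((∫⁻ z, A z ∂P) + ((∫⁻ z, ∫⁻ z', B (z, z') ∂P ∂P) +
          ((∫⁻ z, ∫⁻ z', D (z, z') ∂P ∂P) + ∫⁻ z, A z ∂P))) := by
        have hBz : ∀ z, Measurable fun z' => B (z, z') := fun z => hBm.comp measurable_prodMk_left
        have hDz : ∀ z, Measurable fun z' => D (z, z') := fun z => hDm.comp measurable_prodMk_left
        have e : ∀ z, ∫⁻ z', 4 * (A z + (B (z, z') + (D (z, z') + A z'))) ∂P =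
            4 * (A z + ((∫⁻ z', B (z, z') ∂P) + ((∫⁻ z', D (z, z') ∂P) + ∫⁻ z, A z ∂P))) := by
          intro z
          rw [lintegral_const_mul' _ _ (by simp), lintegral_add_left measurable_const,
            lintegral_add_left (hBz z), lintegral_add_left (hDz z), lintegral_const, measure_univ,
            mul_one]
        simp only [e]
        rw [lintegral_const_mul' _ _ (by simp), lintegral_add_left hAm,
          lintegral_add_left hBm.lintegral_prod_right',
          lintegral_add_left hDm.lintegral_prod_right', lintegral_const, measure_univ, mul_one]
    _ = 4 * (2 * (∫⁻ θ, ∫⁻ r, A (θ, r) ∂ν ∂μ) +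
          (∫⁻ θ, ∫⁻ r, ∫⁻ s, ENNReal.ofReal ((u' (θ, r) - u' (θ, s)) ^ 2) ∂ν ∂ν ∂μ) +
          ∫⁻ s, ∫⁻ θ, ∫⁻ η, ENNReal.ofReal ((u' (θ, s) - u' (η, s)) ^ 2) ∂μ ∂μ ∂ν) := by
        rw [hBP, hDP, hAP]
        ring

section Hybrid

variable {n : ℕ} {f K w : ℝ → ℝ} {R : ℝ} {φ : EuclideanSpace ℝ (Fin n) → ℝ}

theorem IsRadialProbDensity.lintegral_radialDensity (hn : 0 < n) (h : IsRadialProbDensity n f) :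
    ∫⁻ r in Ioi 0, ENNReal.ofReal (sphereArea n * r ^ (n - 1) * f r) = 1 := by
  have := (h.isProbabilityMeasure_radialLaw hn).measure_univ
  rwa [radialLaw, withDensity_apply _ .univ, setLIntegral_univ] at this

theorem IsRadialProbDensity.integrableOn_radialDensity (hn : 0 < n)
    (h : IsRadialProbDensity n f) :
    IntegrableOn (fun r => r ^ (n - 1) * (sphereArea n * f r)) (Ioi 0) := by
  have hm := h.measurable
  refine ⟨by fun_prop, ?_⟩
  rw [hasFiniteIntegral_iff_ofReal]
  · refine lt_of_le_of_lt (le_of_eq ?_) ENNReal.one_lt_top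
    rw [← h.lintegral_radialDensity hn]
    exact lintegral_congr fun r => by congr 1; ring
  · filter_upwards [ae_restrict_mem measurableSet_Ioi] with r (hr : 0 < r)
    have := h.nonneg r hr.le
    have := sphereArea_pos hn
    positivity

/-- `lintegral_Ioi_sq_le` for the density of the radius. -/
theorem IsRadialProbDensity.lintegral_Ioi_sq_le (hn : 2 ≤ n) (h : IsRadialProbDensity n f)
    (hK : ∀ r, 0 ≤ r → 0 ≤ K r) (hKf : IsRadialSteadyState n K f) (hR : 0 < R)
    (hKR : ∀ r, R ≤ r → ((n : ℝ) - 1) * (K r / r ^ 2) ≤ 1 / 2) {g g' : ℝ → ℝ}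
    (hg : ∀ r, HasDerivAt g (g' r) r) (hg' : Continuous g') :
    ∫⁻ r in Ioi R, ENNReal.ofReal (g r ^ 2 * (sphereArea n * r ^ (n - 1) * f r)) ≤
      8 * (∫⁻ r in Ioi R,
        ENNReal.ofReal (K r * g' r ^ 2 * (sphereArea n * r ^ (n - 1) * f r))) +
        ENNReal.ofReal (2 * g R ^ 2 * (R ^ n * (sphereArea n * f R))) := by
  have hn0 : 0 < n := by omega
  have hσ := sphereArea_pos hn0
  have := _root_.lintegral_Ioi_sq_le (f := fun r => sphereArea n * f r) hn hR
    (fun r hr => mul_nonneg hσ.le (h.nonneg r hr)) hK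
    (fun r hr => by
      have h1 := (hKf.hasDerivAt hn0 hr).const_mul (sphereArea n)
      refine (h1.congr_deriv (by ring)).congr_of_eventuallyEq (.of_forall fun s => ?_)
      ring) hKR (h.integrableOn_radialDensity hn0) hg hg'
  refine le_trans (le_of_eq ?_) (this.trans (le_of_eq ?_))
  · exact lintegral_congr fun r => by congr 1; ring
  · congr 2
    exact lintegral_congr fun r => by congr 1; ring

theorem lintegral_hybridWeight (hn : 0 < n) (hf : Measurable f) (hKf : IsRadialSteadyState n K f)
    (hw : Measurable w) (hφ : ContDiff ℝ ∞ φ) (R : ℝ) :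
    ∫⁻ x, ENNReal.ofReal (hybridWeight w K R ‖x‖ * ‖∇ φ x‖ ^ 2 * f ‖x‖) =
      ∫⁻ θ, ∫⁻ r in Ioi (0 : ℝ), ENNReal.ofReal (hybridWeight w K R r *
        ‖fderiv ℝ φ (r • (θ : EuclideanSpace ℝ (Fin n)))‖ ^ 2 *
          (sphereArea n * r ^ (n - 1) * f r)) ∂volume ∂(uniformSphere n) := by
  have hσ := sphereArea_pos hn
  have hfd : Continuous (fderiv ℝ φ) := hφ.continuous_fderiv (by simp)
  have hgrad : ∀ x, ‖∇ φ x‖ = ‖fderiv ℝ φ x‖ := fun x => by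
    rw [gradient, LinearIsometryEquiv.norm_map]
  -- `K` need not be measurable, but `K f` is continuous
  have hKfm : Measurable fun x : EuclideanSpace ℝ (Fin n) => K ‖x‖ * f ‖x‖ :=
    (continuous_iff_continuousAt.2 fun x => (hKf x).hasFDerivAt.continuousAt).measurable
  have hG : Measurable fun x : EuclideanSpace ℝ (Fin n) =>
      ENNReal.ofReal (hybridWeight w K R ‖x‖ * ‖fderiv ℝ φ x‖ ^ 2 * f ‖x‖) := by
    have e : (fun x : EuclideanSpace ℝ (Fin n) =>
        hybridWeight w K R ‖x‖ * ‖fderiv ℝ φ x‖ ^ 2 * f ‖x‖) = fun x =>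
        if ‖x‖ ≤ R then max (w ‖x‖) (‖x‖ ^ 2) * ‖fderiv ℝ φ x‖ ^ 2 * f ‖x‖
        else K ‖x‖ * f ‖x‖ * ‖fderiv ℝ φ x‖ ^ 2 := by
      funext x
      unfold hybridWeight
      split_ifs <;> ring
    refine ENNReal.measurable_ofReal.comp (e ▸ Measurable.ite ?_ ?_ ?_)
    · exact measurableSet_le measurable_norm measurable_const
    · have := hfd.measurable
      fun_prop
    · have := hfd.measurable
      fun_prop
  simp only [hgrad]
  rw [lintegral_eq_lintegral_uniformSphere hn hG]
  refine lintegral_congr fun θ => setLIntegral_congr_fun measurableSet_Ioi fun r (hr : 0 < r) => ?_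
  have hθ : ‖(θ : EuclideanSpace ℝ (Fin n))‖ = 1 := by simp
  rw [← ENNReal.ofReal_mul (by positivity), norm_smul, hθ, mul_one, Real.norm_of_nonneg hr.le]
  congr 1
  ring

/-- The cost of stopping the radius at `R`, by the Hardy inequality on each ray. -/
theorem lintegral_sq_sub_stopped_le (hn : 2 ≤ n) (h : IsRadialProbDensity n f)
    (hK : ∀ r, 0 ≤ r → 0 ≤ K r) (hKf : IsRadialSteadyState n K f) (hR : 0 < R)
    (hKR : ∀ r, R ≤ r → ((n : ℝ) - 1) * (K r / r ^ 2) ≤ 1 / 2) (hφ : ContDiff ℝ ∞ φ)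
    (θ : Metric.sphere (0 : EuclideanSpace ℝ (Fin n)) 1) :
    ∫⁻ r, ENNReal.ofReal ((φ (r • (θ : EuclideanSpace ℝ (Fin n))) -
        φ (min r R • (θ : EuclideanSpace ℝ (Fin n)))) ^ 2) ∂(radialLaw n f) ≤
      8 * ∫⁻ r in Ioi (0 : ℝ), ENNReal.ofReal (hybridWeight w K R r *
        ‖fderiv ℝ φ (r • (θ : EuclideanSpace ℝ (Fin n)))‖ ^ 2 *
          (sphereArea n * r ^ (n - 1) * f r)) := by
  have hn0 : 0 < n := by omega
  have hσ := sphereArea_pos hn0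
  have hθ : ‖(θ : EuclideanSpace ℝ (Fin n))‖ = 1 := by simp
  have hfd : Continuous (fderiv ℝ φ) := hφ.continuous_fderiv (by simp)
  have hφc := hφ.continuous
  rw [lintegral_radialLaw h.measurable (by fun_prop)]
  have hg : ∀ r, HasDerivAt (fun r : ℝ => φ (r • (θ : EuclideanSpace ℝ (Fin n))) -
      φ (R • (θ : EuclideanSpace ℝ (Fin n)))) (fderiv ℝ φ (r • (θ : EuclideanSpace ℝ (Fin n))) θ)
      r := fun r => (hasDerivAt_comp_smul_right hφ _ r).sub_const _
  have hg' : Continuous fun r : ℝ => fderiv ℝ φ (r • (θ : EuclideanSpace ℝ (Fin n))) θ :=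
    (hfd.comp (by fun_prop)).clm_apply continuous_const
  have hmain := h.lintegral_Ioi_sq_le hn hK hKf hR hKR hg hg'
  simp only [sub_self, ne_eq, OfNat.ofNat_ne_zero, not_false_eq_true, zero_pow, mul_zero, zero_mul,
    ENNReal.ofReal_zero, add_zero] at hmain
  calc _ = ∫⁻ r in Ioi (0 : ℝ), (Ioi R).indicator (fun r => ENNReal.ofReal
          ((φ (r • (θ : EuclideanSpace ℝ (Fin n))) -
            φ (R • (θ : EuclideanSpace ℝ (Fin n)))) ^ 2 *
              (sphereArea n * r ^ (n - 1) * f r))) r := by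
        refine setLIntegral_congr_fun measurableSet_Ioi fun r (hr : 0 < r) => ?_
        rcases le_or_gt r R with hrR | hrR
        · simp [indicator, hrR.not_gt, min_eq_left hrR]
        · simp only [indicator, mem_Ioi, hrR, if_true, min_eq_right hrR.le]
          rw [ENNReal.ofReal_mul (sq_nonneg _)]
    _ ≤ ∫⁻ r in Ioi R, ENNReal.ofReal
          ((φ (r • (θ : EuclideanSpace ℝ (Fin n))) -
            φ (R • (θ : EuclideanSpace ℝ (Fin n)))) ^ 2 *
              (sphereArea n * r ^ (n - 1) * f r)) := by
        rw [setLIntegral_indicator measurableSet_Ioi]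
        exact lintegral_mono_set inter_subset_left
    _ ≤ _ := hmain
    _ ≤ 8 * ∫⁻ r in Ioi R, ENNReal.ofReal (hybridWeight w K R r *
          ‖fderiv ℝ φ (r • (θ : EuclideanSpace ℝ (Fin n)))‖ ^ 2 *
            (sphereArea n * r ^ (n - 1) * f r)) := by
        refine mul_le_mul' le_rfl (setLIntegral_mono' measurableSet_Ioi fun r (hr : R < r) => ?_)
        have hr0 : 0 < r := hR.trans hr
        have h1 := hK r hr0.le
        have h2 := h.nonneg r hr0.le
        have h3 := abs_fderiv_apply_le (φ := φ) hθ (r • (θ : EuclideanSpace ℝ (Fin n)))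
        rw [hybridWeight, if_neg hr.not_ge, ← sq_abs (fderiv ℝ φ _ _)]
        gcongr
    _ ≤ _ := mul_le_mul' le_rfl (lintegral_mono_set (Ioi_subset_Ioi hR.le))

theorem lintegral_stopped_sq_sub_le (hn : 0 < n) (h : IsRadialProbDensity n f)
    (hw : ∀ r, 0 < r → 0 ≤ w r)
    (hP : WeightedPoincareOn (Ioi 0) (fun ρ => sphereArea n * ρ ^ (n - 1) * f ρ) w) (hR : 0 < R)
    (hφ : ContDiff ℝ ∞ φ) {M : ℝ} (hφM : ∀ x, |φ x| ≤ M) (hφM' : ∀ x, ‖fderiv ℝ φ x‖ ≤ M)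
    (θ : Metric.sphere (0 : EuclideanSpace ℝ (Fin n)) 1) :
    ∫⁻ r, ∫⁻ s, ENNReal.ofReal ((φ (min r R • (θ : EuclideanSpace ℝ (Fin n))) -
        φ (min s R • (θ : EuclideanSpace ℝ (Fin n)))) ^ 2) ∂(radialLaw n f) ∂(radialLaw n f) ≤
      6 * ∫⁻ r in Ioi (0 : ℝ), ENNReal.ofReal (hybridWeight w K R r *
        ‖fderiv ℝ φ (r • (θ : EuclideanSpace ℝ (Fin n)))‖ ^ 2 *
          (sphereArea n * r ^ (n - 1) * f r)) := by
  have hσ := sphereArea_pos hn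
  have hfm := h.measurable
  have hθ : ‖(θ : EuclideanSpace ℝ (Fin n))‖ = 1 := by simp
  have hd : ∀ r, |deriv (fun r : ℝ => φ (r • (θ : EuclideanSpace ℝ (Fin n)))) r| ≤
      ‖fderiv ℝ φ (r • (θ : EuclideanSpace ℝ (Fin n)))‖ := fun r => by
    rw [(hasDerivAt_comp_smul_right hφ _ r).deriv]
    exact abs_fderiv_apply_le hθ _
  refine (hP.lintegral_stopped_sq_sub_le (by fun_prop)
    (fun r hr => mul_nonneg (by positivity) (h.nonneg r hr.le)) (h.lintegral_radialDensity hn) hw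
    (F := fun r : ℝ => φ (r • (θ : EuclideanSpace ℝ (Fin n))))
    (hφ.comp (contDiff_id.smul contDiff_const)) (fun r => hφM _)
    (fun r => (hd r).trans (hφM' _)) hR rfl).trans (mul_le_mul' le_rfl ?_)
  refine le_trans ?_ (lintegral_mono_set (Ioc_subset_Ioi_self : Ioc 0 R ⊆ Ioi 0))
  refine setLIntegral_mono' measurableSet_Ioc fun r hr => ?_
  have h1 := hw r hr.1
  have h2 := h.nonneg r hr.1.le
  have h3 := hr.1
  rw [hybridWeight, if_pos hr.2, ← sq_abs (deriv _ _)]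
  have h4 := hd r
  gcongr
  exact le_max_left _ _

/-- The energy of the stopped function in the angular directions. The part of the mass outside
the ball sees the sphere of radius `R` only, and the tail of the density is controlled by its
value at `R`. -/
theorem lintegral_stopped_fderiv_sq_le (hn : 2 ≤ n) (h : IsRadialProbDensity n f)
    (hK : ∀ r, 0 ≤ r → 0 ≤ K r) (hKf : IsRadialSteadyState n K f) (hR : 0 < R)
    (hKR : ∀ r, R ≤ r → ((n : ℝ) - 1) * (K r / r ^ 2) ≤ 1 / 2) (hφ : ContDiff ℝ ∞ φ)
    (θ : Metric.sphere (0 : EuclideanSpace ℝ (Fin n)) 1) :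
    ∫⁻ r, ENNReal.ofReal (min r R ^ 2 *
        ‖fderiv ℝ φ (min r R • (θ : EuclideanSpace ℝ (Fin n)))‖ ^ 2) ∂(radialLaw n f) ≤
      (∫⁻ r in Ioi (0 : ℝ), ENNReal.ofReal (hybridWeight w K R r *
        ‖fderiv ℝ φ (r • (θ : EuclideanSpace ℝ (Fin n)))‖ ^ 2 *
          (sphereArea n * r ^ (n - 1) * f r))) +
      ENNReal.ofReal (2 * (R ^ n * (sphereArea n * f R)) * R ^ 2) * ENNReal.ofReal
        (‖fderiv ℝ φ (R • (θ : EuclideanSpace ℝ (Fin n)))‖ ^ 2) := by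
  have hn0 : 0 < n := by omega
  have hσ := sphereArea_pos hn0
  have hfd : Continuous (fderiv ℝ φ) := hφ.continuous_fderiv (by simp)
  have hfR := h.nonneg R hR.le
  have htail := h.lintegral_Ioi_sq_le hn hK hKf hR hKR (fun r => hasDerivAt_const r (1 : ℝ))
    continuous_const
  simp only [ne_eq, OfNat.ofNat_ne_zero, not_false_eq_true, zero_pow, mul_zero, zero_mul,
    ENNReal.ofReal_zero, lintegral_zero, zero_add, one_pow, one_mul, mul_one] at htail
  have hc : Continuous fun r : ℝ => fderiv ℝ φ (min r R • (θ : EuclideanSpace ℝ (Fin n))) :=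
    hfd.comp (by fun_prop)
  have hcm := hc.measurable
  rw [lintegral_radialLaw h.measurable (by fun_prop), ← Ioc_union_Ioi_eq_Ioi hR.le,
    lintegral_union measurableSet_Ioi (Ioc_disjoint_Ioi le_rfl)]
  refine add_le_add ?_ ?_
  · refine le_trans ?_ (lintegral_mono_set subset_union_left)
    refine setLIntegral_mono' measurableSet_Ioc fun r hr => ?_
    have h2 := h.nonneg r hr.1.le
    have h3 := hr.1
    rw [min_eq_left hr.2, ← ENNReal.ofReal_mul (by positivity), hybridWeight, if_pos hr.2]
    gcongr
    exact le_max_right _ _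
  · calc _ = ∫⁻ r in Ioi R, ENNReal.ofReal (R ^ 2 *
            ‖fderiv ℝ φ (R • (θ : EuclideanSpace ℝ (Fin n)))‖ ^ 2) *
              ENNReal.ofReal (sphereArea n * r ^ (n - 1) * f r) :=
          setLIntegral_congr_fun measurableSet_Ioi fun r (hr : R < r) => by
            rw [min_eq_right hr.le]
      _ ≤ ENNReal.ofReal (R ^ 2 *
            ‖fderiv ℝ φ (R • (θ : EuclideanSpace ℝ (Fin n)))‖ ^ 2) *
              ENNReal.ofReal (2 * (R ^ n * (sphereArea n * f R))) := by
          rw [lintegral_const_mul' _ _ ENNReal.ofReal_ne_top]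
          exact mul_le_mul' le_rfl htail
      _ = _ := by
          rw [← ENNReal.ofReal_mul (by positivity), ← ENNReal.ofReal_mul (by positivity)]
          congr 1
          ring

end Hybrid

theorem theorem6p1 :
    ∃ c : ℝ → ℝ, (∀ R : ℝ, 0 < R → 0 < c R) ∧
      ∀ n : ℕ, 2 ≤ n → ∃ C : ℝ, 0 < C ∧
        ∀ (f K w : ℝ → ℝ) (R : ℝ),
          IsRadialProbDensity n f →
          (∀ r : ℝ, 0 ≤ r → 0 ≤ K r) →
          IsRadialSteadyState n K f →
          0 < R →
          (∀ r : ℝ, R ≤ r → ((n : ℝ) - 1) * (K r / r ^ 2) ≤ 1 / 2) →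
          Measurable w →
          (∀ ρ : ℝ, 0 < ρ → 0 ≤ w ρ) →
          WeightedPoincareOn (Ioi 0) (fun ρ => sphereArea n * ρ ^ (n - 1) * f ρ) w →
          ∀ φ : EuclideanSpace ℝ (Fin n) → ℝ,
            ContDiff ℝ ∞ φ →
            (∃ M : ℝ, ∀ x, |φ x| + ‖∇ φ x‖ ≤ M) →
            ENNReal.ofReal ((∫ x, φ x ^ 2 * f ‖x‖) - (∫ x, φ x * f ‖x‖) ^ 2) ≤
              ENNReal.ofReal C *
                ((∫⁻ x, ENNReal.ofReal (hybridWeight w K R ‖x‖ * ‖∇ φ x‖ ^ 2 * f ‖x‖)) +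
                  ENNReal.ofReal (c R) *
                    ∫⁻ x, ENNReal.ofReal (‖∇ φ x‖ ^ 2 * f ‖x‖) ∂(surfaceMeasure n R)) := by
  refine ⟨fun R => R ^ 3, fun R hR => by positivity, fun n hn => ?_⟩
  have hn0 : 0 < n := by omega
  have hσ := sphereArea_pos hn0
  set C₀ : ℝ := 4 * Real.pi * 2 ^ n * n
  have hC₀0 : 0 ≤ C₀ := by positivity
  refine ⟨4 * (22 + 2 * C₀), by positivity, ?_⟩
  intro f K w R h hK hKf hR hKR hwm hw hP φ hφ ⟨M, hM⟩
  have hfm := h.measurable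
  have hfd : Continuous (fderiv ℝ φ) := hφ.continuous_fderiv (by simp)
  have hgrad : ∀ x, ‖∇ φ x‖ = ‖fderiv ℝ φ x‖ := fun x => by
    rw [gradient, LinearIsometryEquiv.norm_map]
  have hφM : ∀ x, |φ x| ≤ M := fun x => by linarith [hM x, norm_nonneg (∇ φ x)]
  have hφM' : ∀ x, ‖fderiv ℝ φ x‖ ≤ M := fun x => by
    rw [← hgrad]; linarith [hM x, abs_nonneg (φ x)]
  have hfR := h.nonneg R hR.le
  have := isProbabilityMeasure_uniformSphere hn0
  have := h.isProbabilityMeasure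
  have := h.isProbabilityMeasure_radialLaw hn0
  have hdens : ∀ g : EuclideanSpace ℝ (Fin n) → ℝ,
      ∫ x, g x * f ‖x‖ = ∫ x, g x ∂(radialMeasure n f) := by
    intro g
    rw [radialMeasure, integral_withDensity_eq_integral_toReal_smul (by fun_prop)
      (.of_forall fun x => ENNReal.ofReal_lt_top)]
    refine integral_congr_ae (.of_forall fun x => ?_)
    simp only
    rw [ENNReal.toReal_ofReal (h.nonneg _ (norm_nonneg x)), smul_eq_mul, mul_comm]
  rw [hdens (fun x => φ x ^ 2), hdens φ, lintegral_hybridWeight hn0 hfm hKf hwm hφ R]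
  simp only [hgrad]
  have hfdm := hfd.measurable
  rw [lintegral_surfaceMeasure hn0 (by fun_prop)]
  set W : Metric.sphere (0 : EuclideanSpace ℝ (Fin n)) 1 → ENNReal := fun θ =>
    ∫⁻ r in Ioi (0 : ℝ), ENNReal.ofReal (hybridWeight w K R r *
      ‖fderiv ℝ φ (r • (θ : EuclideanSpace ℝ (Fin n)))‖ ^ 2 *
        (sphereArea n * r ^ (n - 1) * f r))
  set B := ENNReal.ofReal (R ^ 3) * (ENNReal.ofReal (R ^ (n - 1)) *
    (ENNReal.ofReal (sphereArea n) * ∫⁻ θ : Metric.sphere (0 : EuclideanSpace ℝ (Fin n)) 1,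
      ENNReal.ofReal (‖fderiv ℝ φ (R • (θ : EuclideanSpace ℝ (Fin n)))‖ ^ 2 *
        f ‖R • (θ : EuclideanSpace ℝ (Fin n))‖) ∂(uniformSphere n))) with hB
  have hBeq : ∫⁻ θ : Metric.sphere (0 : EuclideanSpace ℝ (Fin n)) 1,
      ENNReal.ofReal (2 * (R ^ n * (sphereArea n * f R)) * R ^ 2) * ENNReal.ofReal
        (‖fderiv ℝ φ (R • (θ : EuclideanSpace ℝ (Fin n)))‖ ^ 2) ∂(uniformSphere n) = 2 * B := by
    have hnorm : ∀ θ : Metric.sphere (0 : EuclideanSpace ℝ (Fin n)) 1,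
        ‖R • (θ : EuclideanSpace ℝ (Fin n))‖ = R := fun θ => by
      rw [norm_smul, Real.norm_of_nonneg hR.le]; simp
    have htwo : ∀ x : ℝ, 2 * ENNReal.ofReal x = ENNReal.ofReal (2 * x) := fun x => by
      rw [ENNReal.ofReal_mul (by norm_num), ENNReal.ofReal_ofNat]
    simp only [hB, hnorm]
    rw [← lintegral_const_mul' _ _ ENNReal.ofReal_ne_top,
      ← lintegral_const_mul' _ _ ENNReal.ofReal_ne_top,
      ← lintegral_const_mul' _ _ ENNReal.ofReal_ne_top, ← lintegral_const_mul' _ _ (by simp)]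
    refine lintegral_congr fun θ => ?_
    rw [← ENNReal.ofReal_mul (by positivity), ← ENNReal.ofReal_mul (by positivity),
      ← ENNReal.ofReal_mul (by positivity), ← ENNReal.ofReal_mul (by positivity), htwo]
    congr 1
    obtain ⟨m, rfl⟩ : ∃ m, n = m + 1 := ⟨n - 1, by omega⟩
    rw [Nat.add_sub_cancel]
    ring
  have hang : ∫⁻ s, ∫⁻ θ, ∫⁻ η, ENNReal.ofReal
      ((φ (min s R • (θ : EuclideanSpace ℝ (Fin n))) -
        φ (min s R • (η : EuclideanSpace ℝ (Fin n)))) ^ 2) ∂(uniformSphere n)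
          ∂(uniformSphere n) ∂(radialLaw n f) ≤
      ENNReal.ofReal C₀ * ((∫⁻ θ, W θ ∂(uniformSphere n)) + 2 * B) := by
    have hjoint : Measurable fun q : ℝ × Metric.sphere (0 : EuclideanSpace ℝ (Fin n)) 1 =>
        ENNReal.ofReal (min q.1 R ^ 2 *
          ‖fderiv ℝ φ (min q.1 R • (q.2 : EuclideanSpace ℝ (Fin n)))‖ ^ 2) := by
      have h1 : Continuous fun q : ℝ × Metric.sphere (0 : EuclideanSpace ℝ (Fin n)) 1 =>
        fderiv ℝ φ (min q.1 R • (q.2 : EuclideanSpace ℝ (Fin n))) := hfd.comp (by fun_prop)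
      exact (ENNReal.continuous_ofReal.comp (by fun_prop)).measurable
    calc _ ≤ ∫⁻ s, ENNReal.ofReal C₀ * ∫⁻ θ, ENNReal.ofReal (min s R ^ 2 *
            ‖fderiv ℝ φ (min s R • (θ : EuclideanSpace ℝ (Fin n)))‖ ^ 2) ∂(uniformSphere n)
              ∂(radialLaw n f) :=
          lintegral_mono fun s =>
            lintegral_uniformSphere_sq_sub_le hn (hφ.of_le (by simp)) (min s R)
      _ = ENNReal.ofReal C₀ * ∫⁻ θ, ∫⁻ s, ENNReal.ofReal (min s R ^ 2 *
            ‖fderiv ℝ φ (min s R • (θ : EuclideanSpace ℝ (Fin n)))‖ ^ 2) ∂(radialLaw n f)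
              ∂(uniformSphere n) := by
          rw [lintegral_const_mul' _ _ ENNReal.ofReal_ne_top,
            lintegral_lintegral_swap hjoint.aemeasurable]
      _ ≤ ENNReal.ofReal C₀ * ∫⁻ θ : Metric.sphere (0 : EuclideanSpace ℝ (Fin n)) 1,
            (W θ + ENNReal.ofReal (2 * (R ^ n * (sphereArea n * f R)) * R ^ 2) * ENNReal.ofReal
              (‖fderiv ℝ φ (R • (θ : EuclideanSpace ℝ (Fin n)))‖ ^ 2)) ∂(uniformSphere n) :=
          mul_le_mul' le_rfl (lintegral_mono fun θ =>
            lintegral_stopped_fderiv_sq_le hn h hK hKf hR hKR hφ θ)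
      _ = _ := by
          have h1 : Continuous fun θ : Metric.sphere (0 : EuclideanSpace ℝ (Fin n)) 1 =>
            fderiv ℝ φ (R • (θ : EuclideanSpace ℝ (Fin n))) := hfd.comp (by fun_prop)
          have h2 : Continuous fun θ : Metric.sphere (0 : EuclideanSpace ℝ (Fin n)) 1 =>
            ENNReal.ofReal (‖fderiv ℝ φ (R • (θ : EuclideanSpace ℝ (Fin n)))‖ ^ 2) :=
            ENNReal.continuous_ofReal.comp (by fun_prop)
          rw [lintegral_add_right _ (h2.measurable.const_mul _), hBeq]
  have hvar := ofReal_variance_le_lintegral_sq_sub (P := radialMeasure n f)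
    hφ.continuous.measurable hφM
  have hφc := hφ.continuous
  have hsq : Measurable fun q : EuclideanSpace ℝ (Fin n) × EuclideanSpace ℝ (Fin n) =>
      ENNReal.ofReal ((φ q.1 - φ q.2) ^ 2) :=
    (ENNReal.continuous_ofReal.comp (by fun_prop)).measurable
  rw [lintegral_radialMeasure hn0 hfm hsq.lintegral_prod_right'] at hvar
  have hinner : ∀ x, ∫⁻ y, ENNReal.ofReal ((φ x - φ y) ^ 2) ∂(radialMeasure n f) =
      ∫⁻ η, ∫⁻ s, ENNReal.ofReal ((φ x - φ (s • (η : EuclideanSpace ℝ (Fin n)))) ^ 2)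
        ∂(radialLaw n f) ∂(uniformSphere n) := fun x =>
    lintegral_radialMeasure hn0 hfm (G := fun y => ENNReal.ofReal ((φ x - φ y) ^ 2))
      (hsq.comp measurable_prodMk_left)
  simp only [hinner] at hvar
  have hcompare := lintegral_sq_sub_le_stopped
    (u := fun z : Metric.sphere (0 : EuclideanSpace ℝ (Fin n)) 1 × ℝ =>
      φ (z.2 • (z.1 : EuclideanSpace ℝ (Fin n)))) (hφc.comp (by fun_prop)) R (uniformSphere n)
    (radialLaw n f)
  refine hvar.trans (hcompare.trans ?_)
  have h1 : ∫⁻ θ, ∫⁻ r, ENNReal.ofReal ((φ (r • (θ : EuclideanSpace ℝ (Fin n))) -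
      φ (min r R • (θ : EuclideanSpace ℝ (Fin n)))) ^ 2) ∂(radialLaw n f) ∂(uniformSphere n) ≤
      8 * ∫⁻ θ, W θ ∂(uniformSphere n) := by
    rw [← lintegral_const_mul' _ _ (by simp)]
    exact lintegral_mono fun θ => lintegral_sq_sub_stopped_le hn h hK hKf hR hKR hφ θ
  have h2 : ∫⁻ θ, ∫⁻ r, ∫⁻ s, ENNReal.ofReal ((φ (min r R • (θ : EuclideanSpace ℝ (Fin n))) -
      φ (min s R • (θ : EuclideanSpace ℝ (Fin n)))) ^ 2) ∂(radialLaw n f) ∂(radialLaw n f)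
        ∂(uniformSphere n) ≤ 6 * ∫⁻ θ, W θ ∂(uniformSphere n) := by
    rw [← lintegral_const_mul' _ _ (by simp)]
    exact lintegral_mono fun θ => lintegral_stopped_sq_sub_le hn0 h hw hP hR hφ hφM hφM' θ
  set I := ∫⁻ θ, W θ ∂(uniformSphere n)
  calc _ ≤ 4 * (2 * (8 * I) + 6 * I + ENNReal.ofReal C₀ * (I + 2 * B)) :=
        mul_le_mul' le_rfl (add_le_add (add_le_add (mul_le_mul' le_rfl h1) h2) hang)
    _ ≤ 4 * (2 * (8 * I) + 6 * I + ENNReal.ofReal C₀ * (I + 2 * B)) +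
          4 * (22 * B + ENNReal.ofReal C₀ * I) := le_self_add
    _ = 4 * (22 + 2 * ENNReal.ofReal C₀) * (I + B) := by ring
    _ = _ := by
        rw [ENNReal.ofReal_mul (p := 4) (by norm_num),
          ENNReal.ofReal_add (p := 22) (by norm_num) (by positivity),
          ENNReal.ofReal_mul (p := 2) (by norm_num), ENNReal.ofReal_ofNat, ENNReal.ofReal_ofNat,
          ENNReal.ofReal_ofNat]
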